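/- Let $r\in(0,\pi)$ and let $B=\{x\in\mathbb S^2:\theta_x\le r\}$ be the spherical cap of radius $r$ centred at the North Pole, where $\theta_x\in[0,\pi]$ is the colatitude of $x$; let $dx$ be the surface measure on $\mathbb S^2$ (of total mass $4\pi$). For $\ell\in\mathbb N$ let $$T_\ell(x)=\sqrt{\tfrac{4\pi}{2\ell+1}}\sum_{m=-\ell}^{\ell}a_{\ell m}Y_{\ell m}(x),$$ where $Y_{\ell m}$ are the standard complex orthonormal spherical harmonics and, for each $\ell$, the random coefficients satisfy $a_{\ell,-m}=(-1)^m\overline{a_{\ell m}}$, are otherwise independent, $a_{\ell 0}$ being a standard real Gaussian variable and $a_{\ell m}$, $m\neq0$, standard complex Gaussian variables ($\mathbb E|a_{\ell m}|^2=1$). Let $H_2(t)=t^2-1$. Let $M,k$ be integers with $1\le M\le k$, put $q_{2k+1}(t)=\sum_{i=0}^{k}\binom{2k+1}{i}t^i(1-t)^{2k+1-i}$, and for $\varepsilon>0$ let the smoothed indicator of $B$ be $1_{B,\varepsilon}(x)=\phi_{r,\varepsilon}(\theta_x)$, where $\phi_{r,\varepsilon}(\theta)=1$ for $\theta<r-\varepsilon$,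 $\phi_{r,\varepsilon}(\theta)=q_{2k+1}\big(\frac{\theta-r+\varepsilon}{\varepsilon}\big)$ for $r-\varepsilon\le\theta\le r$, and $\phi_{r,\varepsilon}(\theta)=0$ for $\theta>r$. Let $$b_{\ell_1;\varepsilon}=2\pi\sqrt{\tfrac{2\ell_1+1}{4\pi}}\int_{-1}^{1}\phi_{r,\varepsilon}(\arccos\mu)\,P_{\ell_1}(\mu)\,d\mu$$ ($P_{\ell_1}$ the Legendre polynomials) be its coefficients in the expansion $1_{B,\varepsilon}=\sum_{\ell_1\ge0}b_{\ell_1;\varepsilon}Y_{\ell_1 0}$. Let $\varepsilon=\varepsilon_\ell>0$ be a sequence with $\varepsilon_\ell\to0$ as $\ell\to\infty$ and $\ell^{M-1}\varepsilon_\ell^{2M+1}>\ell^2$ for all sufficiently large $\ell$. Then, for every $\ell$, the function $x\mapsto H_2(T_\ell(x))$ is integrable on $B$ for every outcome, the random variable $\int_B H_2(T_\ell(x))\,dx$ is square integrable, the series below converges, and, as $\ell\to\infty$, $$\operatorname{Var}\Big(\int_B H_2(T_\ell(x))\,dx\Big)=8\pi\sum_{\ell_1=0}^{\infty}b_{\ell_1;\varepsilon_\ell}^2\,\frac{1}{2\ell_1+1}\Big(C_{\ell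 0\ell 0}^{\ell_1 0}\Big)^2+o\Big(\frac1\ell\Big),$$ where $C_{\ell 0\ell 0}^{\ell_1 0}$ are the Clebsch-Gordan coefficients (equal to $0$ for $\ell_1>2\ell$). -/

import Mathlib

open MeasureTheory ProbabilityTheory Filter Topology Asymptotics

namespace CapChaos

noncomputable section

/-! ### The unit sphere, spherical coordinates and spherical caps -/

/-- The unit sphere of `ℝ³`. -/
abbrev Sphere2 : Type := Metric.sphere (0 : EuclideanSpace ℝ (Fin 3)) 1

/-- The surface (Lebesgue) measure on the unit sphere, of total mass `4π`. -/
def surfaceMeasure : Measure Sphere2 :=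
  (volume : Measure (EuclideanSpace ℝ (Fin 3))).toSphere

/-- The colatitude `θ ∈ [0, π]` of a point, measured from the North Pole `(0, 0, 1)`. -/
def colatitude (x : Sphere2) : ℝ := Real.arccos (x.1 2)

/-- The longitude `φ` of a point, taken in `(-π, π]` (and `0` at the two poles). -/
def longitude (x : Sphere2) : ℝ := Complex.arg ⟨x.1 0, x.1 1⟩

/-- The spherical cap of radius `r` centred at the North Pole. -/
def cap (r : ℝ) : Set Sphere2 := {x | colatitude x ≤ r}

/-! ### Legendre polynomials and spherical harmonics -/

/-- The Legendre polynomial `P_ℓ`, by the Rodrigues formula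
`P_ℓ(t) = (2^ℓ ℓ!)⁻¹ (d/dt)^ℓ (t² - 1)^ℓ`. -/
def legendre (l : ℕ) : Polynomial ℝ :=
  Polynomial.C ((2 ^ l * (l.factorial : ℝ))⁻¹) *
    Polynomial.derivative^[l] ((Polynomial.X ^ 2 - 1) ^ l)

/-- The associated Legendre function
`P_{ℓm}(t) = (-1)^m (1 - t²)^{m/2} (d/dt)^m P_ℓ(t)`, for `m ≥ 0` and `t ∈ [-1, 1]`. -/
def assocLegendre (l m : ℕ) (t : ℝ) : ℝ :=
  (-1) ^ m * Real.sqrt (1 - t ^ 2) ^ m * (Polynomial.derivative^[m] (legendre l)).eval t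

/-- The spherical harmonic `Y_{ℓm}(θ, φ)` for `0 ≤ m ≤ ℓ`. -/
def sphHarmonicNat (l m : ℕ) (θ φ : ℝ) : ℂ :=
  ((Real.sqrt ((2 * l + 1) / (4 * Real.pi)) *
      Real.sqrt (((l - m).factorial : ℝ) / ((l + m).factorial : ℝ)) *
      assocLegendre l m (Real.cos θ) : ℝ) : ℂ) * Complex.exp (Complex.I * m * φ)

/-- The spherical harmonic `Y_{ℓm}(θ, φ)` for `-ℓ ≤ m ≤ ℓ`, with
`Y_{ℓm} = (-1)^m conj(Y_{ℓ,-m})` for `m < 0`. -/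
def sphHarmonic (l : ℕ) (m : ℤ) (θ φ : ℝ) : ℂ :=
  if 0 ≤ m then sphHarmonicNat l m.natAbs θ φ
  else (-1) ^ m.natAbs * starRingEnd ℂ (sphHarmonicNat l m.natAbs θ φ)

/-! ### Gaussian random spherical harmonics -/

/-- The standard complex Gaussian law: independent real and imaginary parts, both `N(0, 1/2)`. -/
def stdComplexGaussian : Measure ℂ :=
  ((gaussianReal 0 (1 / 2)).prod (gaussianReal 0 (1 / 2))).map fun p => (⟨p.1, p.2⟩ : ℂ)

/-- The random coefficients `(a_{ℓm})_{-ℓ ≤ m ≤ ℓ}` of degree `ℓ`: they are subject to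
`a_{ℓ,-m} = (-1)^m conj(a_{ℓm})` (so that `a_{ℓ0}` is real) and otherwise independent, `a_{ℓ0}` is
real standard Gaussian, and `a_{ℓm}` is standard complex Gaussian for `m ≠ 0` (for `m < 0` this
follows from the case `m > 0`). -/
structure IsGaussianCoeff {Ω : Type*} [MeasurableSpace Ω] (l : ℕ) (a : ℤ → Ω → ℂ)
    (P : Measure Ω) : Prop where
  conj_symm : ∀ m : ℤ, m.natAbs ≤ l → ∀ ω, a (-m) ω = (-1) ^ m.natAbs * starRingEnd ℂ (a m ω)
  law_zero : HasLaw (a 0) ((gaussianReal 0 1).map fun t : ℝ => (t : ℂ)) P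
  law_pos : ∀ m : ℕ, 1 ≤ m → m ≤ l → HasLaw (a (m : ℤ)) stdComplexGaussian P
  indep : iIndepFun (fun m : Fin (l + 1) => a ((m : ℕ) : ℤ)) P

/-- The sum `√(4π / (2ℓ + 1)) ∑_{m = -ℓ}^{ℓ} a_{ℓm} Y_{ℓm}(x)`, as a complex number. -/
def harmonicSum {Ω : Type*} (l : ℕ) (a : ℤ → Ω → ℂ) (ω : Ω) (x : Sphere2) : ℂ :=
  (Real.sqrt (4 * Real.pi / (2 * l + 1)) : ℂ) *
    ∑ m ∈ Finset.Icc (-(l : ℤ)) (l : ℤ),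
      a m ω * sphHarmonic l m (colatitude x) (longitude x)

/-- The random eigenfunction `T_ℓ(x) = √(4π / (2ℓ + 1)) ∑_{m = -ℓ}^{ℓ} a_{ℓm} Y_{ℓm}(x)`, as a
real number; see `harmonicSum_eq` for the fact that the sum is real. -/
def randomHarmonic {Ω : Type*} (l : ℕ) (a : ℤ → Ω → ℂ) (ω : Ω) (x : Sphere2) : ℝ :=
  (harmonicSum l a ω x).re

/-- The value `H_2(T_ℓ(x))` of the second (probabilists') Hermite polynomial. -/
def hermiteTwo {Ω : Type*} (l : ℕ) (a : ℤ → Ω → ℂ) (ω : Ω) (x : Sphere2) : ℝ :=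
  Polynomial.aeval (randomHarmonic l a ω x) (Polynomial.hermite 2)

/-- The random variable `∫_B H_2(T_ℓ(x)) dx`, with `B` the spherical cap of radius `r`. -/
def secondChaos {Ω : Type*} (r : ℝ) (l : ℕ) (a : ℤ → Ω → ℂ) (ω : Ω) : ℝ :=
  ∫ x in cap r, hermiteTwo l a ω x ∂surfaceMeasure

/-! ### The smoothed indicator function of a cap and its coefficients -/

/-- The polynomial `q_{2k+1}(t) = ∑_{i = 0}^{k} binom(2k+1, i) t^i (1 - t)^{2k+1-i}`. -/
def bernsteinStep (k : ℕ) (t : ℝ) : ℝ :=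
  ∑ i ∈ Finset.range (k + 1), (bernsteinPolynomial ℝ (2 * k + 1) i).eval t

/-- The smoothed indicator function of the cap of radius `r`, as a function of the colatitude:
`1` for `θ < r - ε`, `q_{2k+1}((θ - r + ε) / ε)` for `r - ε ≤ θ ≤ r`, and `0` for `θ > r`. -/
def smoothCap (k : ℕ) (r ε θ : ℝ) : ℝ :=
  if θ < r - ε then 1
  else if θ ≤ r then bernsteinStep k ((θ - r + ε) / ε)
  else 0

/-- The coefficient `b_{ℓ;ε}` of `Y_{ℓ0} = √((2ℓ + 1) / 4π) P_ℓ(cos θ)` in the expansion of the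
smoothed indicator function:
`b_{ℓ;ε} = 2π √((2ℓ + 1) / 4π) ∫_{-1}^{1} 1_{B,ε}(arccos μ) P_ℓ(μ) dμ`. -/
def capCoeff (k : ℕ) (r ε : ℝ) (l : ℕ) : ℝ :=
  2 * Real.pi * Real.sqrt ((2 * l + 1) / (4 * Real.pi)) *
    ∫ μ in (-1 : ℝ)..1, smoothCap k r ε (Real.arccos μ) * (legendre l).eval μ

/-! ### Clebsch-Gordan coefficients -/

/-- The reciprocal factorial `1 / n!` of an integer, which is `0` for `n < 0`. -/
def invFactorial (n : ℤ) : ℝ := if 0 ≤ n then ((n.toNat.factorial : ℕ) : ℝ)⁻¹ else 0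

/-- The factorial `n!` of an integer `n ≥ 0` (only used for such `n`). -/
def intFactorial (n : ℤ) : ℝ := ((n.toNat.factorial : ℕ) : ℝ)

/-- The Clebsch-Gordan coefficient `C_{l₁ m₁ l₂ m₂}^{l₃ m₃}` (integer spins), by the Racah
formula; it vanishes unless `m₁ + m₂ = m₃`, `|mᵢ| ≤ lᵢ` and `|l₁ - l₂| ≤ l₃ ≤ l₁ + l₂`. The sum
runs over all `z` for which no factorial in a denominator has a negative argument. -/
def clebschGordan (l₁ : ℕ) (m₁ : ℤ) (l₂ : ℕ) (m₂ : ℤ) (l₃ : ℕ) (m₃ : ℤ) : ℝ :=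
  if m₁ + m₂ = m₃ ∧ m₁.natAbs ≤ l₁ ∧ m₂.natAbs ≤ l₂ ∧ m₃.natAbs ≤ l₃ ∧
      l₃ ≤ l₁ + l₂ ∧ l₁ ≤ l₂ + l₃ ∧ l₂ ≤ l₁ + l₃ then
    Real.sqrt ((2 * l₃ + 1) *
        (intFactorial (l₁ + l₂ - l₃) * intFactorial (l₁ - l₂ + l₃) *
          intFactorial (-l₁ + l₂ + l₃)) / intFactorial (l₁ + l₂ + l₃ + 1)) *
      Real.sqrt (intFactorial (l₁ + m₁) * intFactorial (l₁ - m₁) *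
        (intFactorial (l₂ + m₂) * intFactorial (l₂ - m₂)) *
        (intFactorial (l₃ + m₃) * intFactorial (l₃ - m₃))) *
      ∑ z ∈ Finset.range (l₁ + l₂ + 1),
        (-1 : ℝ) ^ z * (invFactorial z * invFactorial (l₁ + l₂ - l₃ - z) *
          invFactorial (l₁ - m₁ - z) * invFactorial (l₂ + m₂ - z) *
          invFactorial (l₃ - l₂ + m₁ + z) * invFactorial (l₃ - l₁ - m₂ + z))
  else 0

/-- The term `b_{ℓ₁;ε}² (2ℓ₁ + 1)⁻¹ (C_{ℓ0ℓ0}^{ℓ₁0})²`. -/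
def varianceTerm (k : ℕ) (r ε : ℝ) (l l₁ : ℕ) : ℝ :=
  capCoeff k r ε l₁ ^ 2 * (1 / (2 * l₁ + 1)) * clebschGordan l 0 l 0 l₁ 0 ^ 2

/-- The sum that defines `T_ℓ(x)` is real. -/
theorem harmonicSum_eq {Ω : Type*} [MeasurableSpace Ω] {l : ℕ} {a : ℤ → Ω → ℂ} {P : Measure Ω}
    (ha : IsGaussianCoeff l a P) (ω : Ω) (x : Sphere2) :
    harmonicSum l a ω x = (randomHarmonic l a ω x : ℂ) := by
  have hY : ∀ (m : ℤ) (θ φ : ℝ), sphHarmonic l (-m) θ φ =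
      (-1) ^ m.natAbs * starRingEnd ℂ (sphHarmonic l m θ φ) := by
    intro m θ φ
    have hs : ((-1 : ℂ) ^ m.natAbs) * (-1) ^ m.natAbs = 1 := by
      rw [← mul_pow]; simp
    rcases lt_trichotomy m 0 with h | h | h
    · simp only [sphHarmonic, Int.natAbs_neg, if_pos (by omega : 0 ≤ -m),
        if_neg (by omega : ¬ 0 ≤ m), map_mul, map_pow, map_neg, map_one, Complex.conj_conj]
      rw [← mul_assoc, hs, one_mul]
    · subst h
      simp only [sphHarmonic, sphHarmonicNat]
      simp [Complex.conj_ofReal]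
    · simp only [sphHarmonic, Int.natAbs_neg, if_neg (by omega : ¬ 0 ≤ -m),
        if_pos (by omega : 0 ≤ m)]
  have hc : starRingEnd ℂ (harmonicSum l a ω x) = harmonicSum l a ω x := by
    simp only [harmonicSum, map_mul, map_sum, Complex.conj_ofReal]
    congr 1
    refine Finset.sum_nbij' (fun m => -m) (fun m => -m) ?_ ?_ ?_ ?_ ?_
    · intro m hm; simp only [Finset.mem_Icc] at hm ⊢; omega
    · intro m hm; simp only [Finset.mem_Icc] at hm ⊢; omega
    · intro m _; simp
    · intro m _; simp
    · intro m hm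
      simp only [Finset.mem_Icc] at hm
      rw [ha.conj_symm m (by omega) ω, hY]
      have hs : ((-1 : ℂ) ^ m.natAbs) * (-1) ^ m.natAbs = 1 := by
        rw [← mul_pow]; simp
      linear_combination (-(starRingEnd ℂ (a m ω)) *
        starRingEnd ℂ (sphHarmonic l m (colatitude x) (longitude x))) * hs
  exact (Complex.conj_eq_iff_re.mp hc).symm

end

end CapChaos

/-! The integral of `T_ℓ ^ 2` over the cap is a Hermitian form in the coefficients. The cap is
invariant under rotations about the polar axis, so the longitude integral kills all off-diagonal
terms, and only the `|a_{ℓm}| ^ 2` with `0 ≤ m ≤ ℓ` remain, which are independent. Hence the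
variance is exactly `8π² ∑ w_m Λ(q_m)²` (`variance_secondChaos`), where `q_m` is the normalized
square `assocSq l m`, `w_m` counts the orders `±m`, and `Λ` integrates polynomials over the heights
of the cap.

For every linear functional `Λ`, the Parseval identity `sum_sq_assocSq` turns this form into `∑
(2L+1)/2 ∫ P_ℓ² P_L · Λ(P_L)²`. It rests on the fact that Legendre's operator acts on the `q_m` as a
tridiagonal operator in `m` (`legendreOp_assocSq_succ`), so that `∑ w_m (∫ q_m P_L) q_m` is an
eigenfunction and therefore a multiple of `P_L`. The weight `(2L+1)/2 ∫ P_ℓ² P_L` equals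
`(C_{ℓ0ℓ0}^{L0})²` (`clebschGordan_sq`): the integral is given by Adams' formula, the Racah sum by
Dixon's identity. Thus the series of the theorem is exactly the same quadratic form, with the
smoothed cap in place of the cap (`tsum_varianceTerm`).

It remains to compare two profiles `f, g` with values in `[0, 1]`. Since `q_m ≥ 0` on `[-1, 1]`, `∫
q_m = 2/(2ℓ+1)` for each `m`, and `∑ w_m q_m = 1` (Unsöld), the two forms differ by at most
`4/(2ℓ+1) · ‖f - g‖₁` (`abs_sum_sq_weightedIntegral_sub_le`). The cap and its smoothing differ only
in a layer of heights of width at most `ε`, so the error is `O(ε_ℓ / ℓ) = o(1/ℓ)`. -/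

namespace CapChaos

noncomputable section

section

open Polynomial

/-! ### Legendre polynomials -/

/-- `n` times the antiderivative of `P_n` that vanishes at `±1`. -/
def legendreAntideriv (n : ℕ) : ℝ[X] :=
  C ((2 ^ n * (n.factorial : ℝ))⁻¹) * ((n : ℝ[X]) * derivative^[n - 1] ((X ^ 2 - 1) ^ n))

lemma derivative_X_sq_sub_one_pow (n : ℕ) :
    derivative ((X ^ 2 - 1 : ℝ[X]) ^ (n + 1)) =
      C (2 * (n + 1) : ℝ) * ((X ^ 2 - 1) ^ n * X) := by
  rw [derivative_pow_succ]
  simp only [derivative_sub, derivative_X_pow, derivative_one, map_mul, map_add, map_natCast,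
    map_one, map_ofNat]
  push_cast
  ring

lemma derivative_legendreAntideriv (n : ℕ) :
    derivative (legendreAntideriv n) = (n : ℝ[X]) * legendre n := by
  rcases n with _ | n
  · simp [legendreAntideriv]
  · simp only [legendreAntideriv, legendre, derivative_mul, derivative_C, derivative_natCast,
      zero_mul, zero_add, Nat.add_sub_cancel, ← Function.iterate_succ_apply' (derivative)]
    ring

/-- One derivative of the Rodrigues power leaves a multiple of `(X ^ 2 - 1) ^ n * X`; by Leibniz the
linear factor then produces only two terms. -/
lemma legendre_succ (n : ℕ) : legendre (n + 1) = X * legendre n + legendreAntideriv n := by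
  have h : C ((2 ^ (n + 1) * ((n + 1).factorial : ℝ))⁻¹) * C (2 * (n + 1) : ℝ) =
      C ((2 ^ n * (n.factorial : ℝ))⁻¹) := by
    rw [← C_mul]
    congr 1
    rw [Nat.factorial_succ]
    push_cast
    have : (n.factorial : ℝ) ≠ 0 := by positivity
    field_simp
    ring
  simp only [legendre, legendreAntideriv]
  rw [Function.iterate_succ_apply, derivative_X_sq_sub_one_pow, iterate_derivative_C_mul,
    iterate_derivative_mul_X, ← mul_assoc, h, nsmul_eq_mul]
  ring

lemma iterate_derivative_mul_X_sq_sub_one (k : ℕ) (f : ℝ[X]) :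
    derivative^[k + 1] (derivative f * (X ^ 2 - 1)) =
      derivative^[k + 2] f * (X ^ 2 - 1) + 2 * ((k : ℝ[X]) + 1) * derivative^[k + 1] f * X +
        ((k : ℝ[X]) + 1) * (k : ℝ[X]) * derivative^[k] f := by
  have h1 : derivative f * (X ^ 2 - 1) = derivative f * X * X - derivative f := by ring
  -- At `k = 0` the truncated exponent `k - 1` is harmless, because its coefficient vanishes.
  have h2 : (k : ℝ[X]) * derivative^[k - 1] (derivative f) = k * derivative^[k] f := by
    rcases k with _ | k
    · simp
    · rfl
  rw [h1, iterate_derivative_sub, iterate_derivative_mul_X, iterate_derivative_mul_X,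
    Nat.add_sub_cancel, iterate_derivative_mul_X]
  have h3 : derivative^[k + 1] (derivative f) = derivative^[k + 2] f := rfl
  have h4 : derivative^[k] (derivative f) = derivative^[k + 1] f := rfl
  rw [h3, h4]
  simp only [nsmul_eq_mul, h2]
  push_cast
  ring

/-- The power `u = (X ^ 2 - 1) ^ n` satisfies `(X ^ 2 - 1) u' = 2 n X u`; both sides are
differentiated `n` times by Leibniz. -/
lemma X_sq_sub_one_mul_derivative_legendre' (n : ℕ) :
    (X ^ 2 - 1) * derivative (legendre n) = ((n : ℝ[X]) + 1) * legendreAntideriv n := by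
  rcases n with _ | k
  · simp [legendreAntideriv, legendre]
  · have h := iterate_derivative_mul_X_sq_sub_one k ((X ^ 2 - 1 : ℝ[X]) ^ (k + 1))
    have h2 : derivative ((X ^ 2 - 1 : ℝ[X]) ^ (k + 1)) * (X ^ 2 - 1) =
        C (2 * (k + 1) : ℝ) * ((X ^ 2 - 1) ^ (k + 1) * X) := by
      rw [derivative_X_sq_sub_one_pow]; ring
    rw [h2, iterate_derivative_C_mul, iterate_derivative_mul_X] at h
    simp only [legendre, legendreAntideriv, derivative_mul, derivative_C, zero_mul, zero_add,
      ← Function.iterate_succ_apply' (derivative), Nat.add_sub_cancel]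
    simp only [nsmul_eq_mul, map_mul, map_add, map_natCast, map_one, map_ofNat,
      Nat.add_sub_cancel] at h
    push_cast at h ⊢
    linear_combination (-C ((2 ^ (k + 1) * ((k + 1).factorial : ℝ))⁻¹)) * h

lemma X_sq_sub_one_mul_derivative_legendre (n : ℕ) :
    (X ^ 2 - 1) * derivative (legendre n) =
      ((n : ℝ[X]) + 1) * (legendre (n + 1) - X * legendre n) := by
  rw [X_sq_sub_one_mul_derivative_legendre', legendre_succ]; ring

lemma derivative_legendre_succ (n : ℕ) :
    derivative (legendre (n + 1)) =
      X * derivative (legendre n) + ((n : ℝ[X]) + 1) * legendre n := by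
  rw [legendre_succ, derivative_add, derivative_legendreAntideriv, derivative_mul, derivative_X]
  ring

lemma legendre_ode (n : ℕ) :
    derivative ((X ^ 2 - 1) * derivative (legendre n)) =
      (n : ℝ[X]) * ((n : ℝ[X]) + 1) * legendre n := by
  rw [X_sq_sub_one_mul_derivative_legendre', derivative_mul, derivative_legendreAntideriv]
  simp; ring

lemma legendre_three_term (n : ℕ) :
    ((n : ℝ[X]) + 2) * legendre (n + 2) =
      (2 * (n : ℝ[X]) + 3) * (X * legendre (n + 1)) - ((n : ℝ[X]) + 1) * legendre n := by
  have h1 := X_sq_sub_one_mul_derivative_legendre n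
  have h2 := X_sq_sub_one_mul_derivative_legendre (n + 1)
  have h3 := derivative_legendre_succ n
  push_cast at h2
  linear_combination (-1 : ℝ[X]) * h2 + (X ^ 2 - 1) * h3 + X * h1

@[simp] lemma legendre_zero : legendre 0 = 1 := by simp [legendre]

@[simp] lemma legendre_one : legendre 1 = X := by
  rw [legendre_succ]; simp [legendreAntideriv]

@[simp] lemma eval_one_legendre (n : ℕ) : (legendre n).eval 1 = 1 := by
  induction n with
  | zero => simp
  | succ n ih =>
    have h := congrArg (eval 1) (X_sq_sub_one_mul_derivative_legendre n)
    have hn : (n : ℝ) + 1 ≠ 0 := by positivity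
    simp only [eval_mul, eval_sub, eval_pow, eval_X, eval_one, eval_add, eval_natCast, ih] at h
    have := (mul_eq_zero.mp (h.symm.trans (by ring))).resolve_left hn
    linarith

lemma degree_legendre (n : ℕ) : (legendre n).degree = n := by
  have hm : (X ^ 2 - 1 : ℝ[X]).Monic := by
    simpa using monic_X_pow_sub_C (1 : ℝ) (two_ne_zero)
  have hd : (X ^ 2 - 1 : ℝ[X]).natDegree = 2 := by
    simpa using natDegree_X_pow_sub_C (n := 2) (r := (1 : ℝ))
  have hc : ((2 ^ n * (n.factorial : ℝ))⁻¹) ≠ 0 := by positivity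
  refine le_antisymm ?_ ?_
  · refine natDegree_le_iff_degree_le.mp ?_
    rw [legendre, natDegree_C_mul hc]
    refine (natDegree_iterate_derivative _ _).trans ?_
    rw [hm.natDegree_pow, hd]; omega
  · refine le_degree_of_ne_zero ?_
    have h1 : ((X ^ 2 - 1 : ℝ[X]) ^ n).coeff (n + n) = 1 := by
      have := (hm.pow n).coeff_natDegree
      rwa [hm.natDegree_pow, hd, show n * 2 = n + n by ring] at this
    rw [legendre, coeff_C_mul, coeff_iterate_derivative, h1, nsmul_one]
    refine mul_ne_zero hc ?_
    exact_mod_cast (Nat.descFactorial_pos.mpr (by omega)).ne'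

/-- The Legendre polynomials as a sequence with `degree P_n = n`. -/
def legendreSequence : Polynomial.Sequence ℝ := ⟨legendre, degree_legendre⟩

lemma mem_span_legendre (p : ℝ[X]) (N : ℕ) (hp : p.natDegree ≤ N) :
    p ∈ Submodule.span ℝ (legendre '' Set.Iic N) := by
  have h := legendreSequence.span_degreeLE (m := N)
    fun i _ => (isUnit_iff_ne_zero.mpr (leadingCoeff_ne_zero.mpr (legendreSequence.ne_zero i)))
  change Submodule.span ℝ (legendre '' Set.Iic N) = _ at h
  rw [h, mem_degreeLE]
  exact natDegree_le_iff_degree_le.mp hp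

/-! ### Integration of polynomials over `[-1, 1]` -/

/-- Integration over `[-1, 1]` against an integrable function, as a functional on polynomials. -/
def weightedIntegral (f : ℝ → ℝ) (hf : IntervalIntegrable f volume (-1) 1) : ℝ[X] →ₗ[ℝ] ℝ where
  toFun p := ∫ t in (-1 : ℝ)..1, f t * p.eval t
  map_add' p q := by
    simp only [eval_add, mul_add]
    exact intervalIntegral.integral_add (hf.mul_continuousOn p.continuous.continuousOn)
      (hf.mul_continuousOn q.continuous.continuousOn)
  map_smul' c p := by
    simp only [eval_smul, smul_eq_mul, RingHom.id_apply, ← intervalIntegral.integral_const_mul]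
    congr 1; ext t; ring

/-- Integration of polynomials over `[-1, 1]`. -/
def polyIntegral : ℝ[X] →ₗ[ℝ] ℝ := weightedIntegral (fun _ => 1) (by simp)

lemma polyIntegral_apply (p : ℝ[X]) : polyIntegral p = ∫ t in (-1 : ℝ)..1, p.eval t := by
  simp [polyIntegral, weightedIntegral]

lemma polyIntegral_derivative (p : ℝ[X]) :
    polyIntegral (derivative p) = p.eval 1 - p.eval (-1) := by
  rw [polyIntegral_apply]
  exact intervalIntegral.integral_eq_sub_of_hasDerivAt (fun t _ => p.hasDerivAt t)
    ((derivative p).continuous.intervalIntegrable _ _)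

lemma polyIntegral_natCast_mul (n : ℕ) (p : ℝ[X]) :
    polyIntegral (n * p) = n * polyIntegral p := by
  rw [← nsmul_eq_mul, map_nsmul, nsmul_eq_mul]

lemma polyIntegral_C_mul (c : ℝ) (p : ℝ[X]) : polyIntegral (C c * p) = c * polyIntegral p := by
  rw [← smul_eq_C_mul, map_smul, smul_eq_mul]

/-- The operator `p ↦ ((t² - 1) p')'`. -/
def legendreOp : ℝ[X] →ₗ[ℝ] ℝ[X] where
  toFun p := derivative ((X ^ 2 - 1) * derivative p)
  map_add' p q := by simp only [derivative_add, mul_add]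
  map_smul' c p := by simp

lemma legendreOp_apply (p : ℝ[X]) : legendreOp p = derivative ((X ^ 2 - 1) * derivative p) := rfl

lemma legendreOp_legendre (n : ℕ) : legendreOp (legendre n) = C (n * (n + 1) : ℝ) * legendre n := by
  rw [legendreOp_apply, legendre_ode]; simp

lemma polyIntegral_legendreOp (p : ℝ[X]) : polyIntegral (legendreOp p) = 0 := by
  rw [legendreOp_apply, polyIntegral_derivative]; simp

/-- Green's identity: the difference of the integrands is the derivative of `X ^ 2 - 1` times a
Wronskian, which vanishes at `±1`. -/
lemma polyIntegral_legendreOp_mul (p q : ℝ[X]) :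
    polyIntegral (legendreOp p * q) = polyIntegral (p * legendreOp q) := by
  have h : legendreOp p * q - p * legendreOp q =
      derivative ((X ^ 2 - 1) * (derivative p * q - p * derivative q)) := by
    simp only [legendreOp_apply, derivative_mul, derivative_sub]; ring
  have h2 := polyIntegral_derivative ((X ^ 2 - 1) * (derivative p * q - p * derivative q))
  rw [← h, map_sub] at h2
  simp only [eval_mul, eval_sub, eval_pow, eval_X, eval_one] at h2
  linarith

lemma polyIntegral_mul_legendre_of_eigen {p : ℝ[X]} {L n : ℕ} (hLn : L ≠ n)
    (hp : legendreOp p = C (L * (L + 1) : ℝ) * p) : polyIntegral (p * legendre n) = 0 := by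
  have h := polyIntegral_legendreOp_mul p (legendre n)
  rw [hp, legendreOp_legendre, mul_left_comm, mul_assoc, polyIntegral_C_mul,
    polyIntegral_C_mul] at h
  have h2 : ((L : ℝ) - n) * (L + n + 1) * polyIntegral (p * legendre n) = 0 := by
    linear_combination h
  have h3 : ((L : ℝ) - n) ≠ 0 := sub_ne_zero.mpr (by exact_mod_cast hLn)
  have h4 : (L + n + 1 : ℝ) ≠ 0 := by positivity
  simpa [h3, h4] using h2

lemma polyIntegral_legendre_mul_of_ne {m n : ℕ} (h : m ≠ n) :
    polyIntegral (legendre m * legendre n) = 0 :=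
  polyIntegral_mul_legendre_of_eigen h (legendreOp_legendre m)

/-- Testing the three-term recurrence against its lowest and its highest polynomial expresses `∫ X
P_{n+1} P_n` through either of the two neighbouring norms. Hence `(2n+3) ‖P_{n+1}‖² = (2n+1)
‖P_n‖²`. -/
lemma polyIntegral_legendre_sq (n : ℕ) :
    polyIntegral (legendre n * legendre n) = 2 / (2 * n + 1) := by
  have hX (n : ℕ) : (2 * n + 3) * polyIntegral (X * legendre (n + 1) * legendre n) =
      (n + 1) * polyIntegral (legendre n * legendre n) := by
    have h := congrArg (fun p => polyIntegral (p * legendre n)) (legendre_three_term n)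
    have e1 : ((n : ℝ[X]) + 2) * legendre (n + 2) * legendre n =
        ((n + 2 : ℕ) : ℝ[X]) * (legendre (n + 2) * legendre n) := by push_cast; ring
    have e2 : ((2 * (n : ℝ[X]) + 3) * (X * legendre (n + 1)) - ((n : ℝ[X]) + 1) * legendre n) *
        legendre n =
        ((2 * n + 3 : ℕ) : ℝ[X]) * (X * legendre (n + 1) * legendre n) -
          ((n + 1 : ℕ) : ℝ[X]) * (legendre n * legendre n) := by push_cast; ring
    simp only [e1, e2, map_sub, polyIntegral_natCast_mul,
      polyIntegral_legendre_mul_of_ne (by omega : n + 2 ≠ n)] at h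
    push_cast at h
    linarith
  induction n with
  | zero => rw [polyIntegral_apply]; simp; norm_num
  | succ n ih =>
    have hrec : (n + 1) * polyIntegral (legendre (n + 1) * legendre (n + 1)) =
        (2 * n + 1) * polyIntegral (X * legendre (n + 1) * legendre n) := by
      rcases n with _ | n
      · simp
      have h := congrArg (fun p => polyIntegral (p * legendre (n + 2))) (legendre_three_term n)
      have e1 : ((n : ℝ[X]) + 2) * legendre (n + 2) * legendre (n + 2) =
          ((n + 2 : ℕ) : ℝ[X]) * (legendre (n + 2) * legendre (n + 2)) := by push_cast; ring
      have e2 : ((2 * (n : ℝ[X]) + 3) * (X * legendre (n + 1)) - ((n : ℝ[X]) + 1) * legendre n) *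
          legendre (n + 2) =
          ((2 * n + 3 : ℕ) : ℝ[X]) * (X * legendre (n + 1 + 1) * legendre (n + 1)) -
            ((n + 1 : ℕ) : ℝ[X]) * (legendre n * legendre (n + 2)) := by push_cast; ring
      simp only [e1, e2, map_sub, polyIntegral_natCast_mul,
        polyIntegral_legendre_mul_of_ne (by omega : n ≠ n + 2)] at h
      push_cast at h ⊢
      linarith
    have h1 := hX n
    rw [ih] at h1
    have h3 : (2 * (n : ℝ) + 3) ≠ 0 := by positivity
    have h4 : (2 * (n : ℝ) + 1) ≠ 0 := by positivity
    have h5 : ((n : ℝ) + 1) ≠ 0 := by positivity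
    have : polyIntegral (X * legendre (n + 1) * legendre n) =
        (n + 1) * (2 / (2 * n + 1)) / (2 * n + 3) := by
      rw [eq_div_iff h3]; linarith
    rw [this] at hrec
    push_cast
    rw [show (2 * ((n : ℝ) + 1) + 1) = 2 * n + 3 by ring, eq_div_iff h3]
    field_simp at hrec ⊢
    linarith

/-- The expansion of a polynomial in Legendre polynomials. -/
lemma legendre_expansion (p : ℝ[X]) {N : ℕ} (hp : p.natDegree ≤ N) :
    p = ∑ L ∈ Finset.range (N + 1),
      C ((2 * L + 1) / 2 * polyIntegral (p * legendre L)) * legendre L := by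
  refine Submodule.span_induction (p := fun p _ => p = ∑ L ∈ Finset.range (N + 1),
      C ((2 * L + 1) / 2 * polyIntegral (p * legendre L)) * legendre L) ?_ ?_ ?_ ?_
      (mem_span_legendre p N hp)
  · rintro _ ⟨n, hn, rfl⟩
    rw [Finset.sum_eq_single_of_mem n (by simpa [Nat.lt_succ_iff] using hn)]
    · have h4 : (2 * (n : ℝ) + 1) ≠ 0 := by positivity
      rw [polyIntegral_legendre_sq,
        show (2 * (n : ℝ) + 1) / 2 * (2 / (2 * n + 1)) = 1 by field_simp]
      simp
    · intro L _ hL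
      rw [polyIntegral_legendre_mul_of_ne hL.symm]; simp
  · simp
  · intro p q _ _ h1 h2
    conv_lhs => rw [h1, h2]
    simp only [add_mul, map_add, mul_add, Finset.sum_add_distrib]
  · intro c p _ h
    conv_lhs => rw [h]
    rw [Finset.smul_sum]
    refine Finset.sum_congr rfl fun L _ => ?_
    rw [smul_mul_assoc, map_smul, smul_eq_mul, smul_eq_C_mul, ← mul_assoc, ← C_mul]
    congr 2; ring

/-- Polynomial eigenspaces are one-dimensional: orthogonality removes every other Legendre
coefficient, and `P_L(1) = 1` fixes the factor. -/
lemma eq_legendre_of_eigen {p : ℝ[X]} {L : ℕ} (hp : legendreOp p = C (L * (L + 1) : ℝ) * p) :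
    p = C (p.eval 1) * legendre L := by
  have h := legendre_expansion p (le_max_left p.natDegree L)
  rw [Finset.sum_eq_single_of_mem L
    (Finset.mem_range.mpr (Nat.lt_succ_iff.mpr (le_max_right _ _)))
    (fun n _ hn => by rw [polyIntegral_mul_legendre_of_eigen hn.symm hp]; simp)] at h
  have h2 := congrArg (eval 1) h
  simp only [eval_mul, eval_C, eval_one_legendre, mul_one] at h2
  rwa [← h2] at h

/-! ### Integrals of products of three Legendre polynomials -/

/-- The numbers `(2r)! / (2^r r!²)`, extended by `0` to negative `r`. -/
def adamsCoeff (r : ℤ) : ℝ := if 0 ≤ r then (r.toNat.centralBinom : ℝ) / 2 ^ r.toNat else 0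

lemma adamsCoeff_natCast (r : ℕ) : adamsCoeff r = (r.centralBinom : ℝ) / 2 ^ r := by
  simp [adamsCoeff]

lemma adamsCoeff_of_neg {r : ℤ} (hr : r < 0) : adamsCoeff r = 0 := if_neg (by omega)

lemma adamsCoeff_pos {r : ℤ} (hr : 0 ≤ r) : 0 < adamsCoeff r := by
  lift r to ℕ using hr
  rw [adamsCoeff_natCast]
  have := r.centralBinom_pos
  positivity

lemma adamsCoeff_succ (r : ℤ) : (r + 1) * adamsCoeff (r + 1) = (2 * r + 1) * adamsCoeff r := by
  rcases lt_trichotomy r (-1) with h | rfl | h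
  · rw [adamsCoeff_of_neg (by omega), adamsCoeff_of_neg (by omega)]; simp
  · rw [adamsCoeff_of_neg (by omega : (-1 : ℤ) < 0)]; simp
  · lift r to ℕ using by omega
    rw [show (r : ℤ) + 1 = ((r + 1 : ℕ) : ℤ) by push_cast; rfl, adamsCoeff_natCast,
      adamsCoeff_natCast]
    have := congrArg (Nat.cast : ℕ → ℝ) (Nat.succ_mul_centralBinom_succ r)
    push_cast at this ⊢
    rw [pow_succ]
    field_simp
    linarith

lemma int_two_mul_add_one_ne_zero (r : ℤ) : (2 * r + 1 : ℝ) ≠ 0 := by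
  exact_mod_cast (by omega : 2 * r + 1 ≠ 0)

/-- Neighbouring coefficients as multiples of a common factor. Only the odd number `2 r + 1` is
divided by, so the relation survives at `r = -1`. -/
lemma exists_adamsCoeff_eq (r : ℤ) :
    ∃ x : ℝ, adamsCoeff (r + 1) = (2 * r + 1) * x ∧ adamsCoeff r = (r + 1) * x := by
  have h := int_two_mul_add_one_ne_zero r
  refine ⟨adamsCoeff (r + 1) / (2 * r + 1), by field_simp, ?_⟩
  have := adamsCoeff_succ r
  rw [← mul_div_assoc, eq_div_iff h]
  linarith

/-- Adams' expression for `∫ P_m P_n P_L` with `m = b + c`, `n = a + c`, `L = a + b`. -/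
def adamsIntegral (a b c : ℤ) : ℝ :=
  2 * (adamsCoeff a * adamsCoeff b * adamsCoeff c) /
    (adamsCoeff (a + b + c) * (2 * (a + b + c) + 1))

/-- Adams' expression obeys the recurrence of `polyIntegral_legendre_triple_recurrence`. Once
neighbouring coefficients share a factor it is a rational identity; `1 ≤ a + b + c` keeps the
denominators nonzero. -/
lemma adamsIntegral_recurrence (a b c : ℤ) (h : 1 ≤ a + b + c) :
    (2 * (a + c) + 1) * ((b + c) * adamsIntegral a b c +
        (b + c - 1) * adamsIntegral (a + 1) (b - 1) (c - 1)) =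
      (2 * (b + c - 1) + 1) * ((a + c + 1) * adamsIntegral (a + 1) (b - 1) c +
        (a + c) * adamsIntegral a b (c - 1)) := by
  obtain ⟨x, hx1, hx2⟩ := exists_adamsCoeff_eq a
  obtain ⟨y, hy1, hy2⟩ := exists_adamsCoeff_eq (b - 1)
  obtain ⟨z, hz1, hz2⟩ := exists_adamsCoeff_eq (c - 1)
  have hs := adamsCoeff_succ (a + b + c - 1)
  have hspos := adamsCoeff_pos (by omega : 0 ≤ a + b + c - 1)
  have hspos' := adamsCoeff_pos (by omega : 0 ≤ a + b + c)
  have h0 : (a + b + c : ℝ) ≠ 0 := by exact_mod_cast (by omega : a + b + c ≠ 0)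
  have h1 := int_two_mul_add_one_ne_zero (a + b + c)
  have h2 := int_two_mul_add_one_ne_zero (a + b + c - 1)
  simp only [sub_add_cancel] at hy1 hy2 hz1 hz2 hs
  push_cast at hy1 hy2 hz1 hz2 hs h1 h2
  have hs' : adamsCoeff (a + b + c) =
      (2 * (a + b + c - 1) + 1) * adamsCoeff (a + b + c - 1) / (a + b + c) := by
    rw [eq_div_iff h0]; linarith
  simp only [adamsIntegral, show a + 1 + (b - 1) + (c - 1) = a + b + c - 1 by ring,
    show a + 1 + (b - 1) + c = a + b + c by ring, show a + b + (c - 1) = a + b + c - 1 by ring]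
  rw [hs', hx1, hx2, hy1, hy2, hz1, hz2]
  generalize adamsCoeff (a + b + c - 1) = w at hspos
  have hw : w ≠ 0 := hspos.ne'
  push_cast
  have e1 : (a + 1 + (b - 1) + c : ℝ) = a + b + c := by ring
  have e2 : (a + 1 + (b - 1) + (c - 1) : ℝ) = a + b + c - 1 := by ring
  have e3 : (a + b + (c - 1) : ℝ) = a + b + c - 1 := by ring
  rw [e1, e2, e3]
  field_simp
  ring

lemma legendre_recurrence (n : ℕ) :
    ((n + 1 : ℕ) : ℝ[X]) * legendre (n + 1) + (n : ℝ[X]) * legendre (n - 1) =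
      ((2 * n + 1 : ℕ) : ℝ[X]) * (X * legendre n) := by
  rcases n with _ | n
  · simp
  · have := legendre_three_term n
    rw [Nat.add_sub_cancel]
    push_cast
    linear_combination this

/-- Two evaluations of `∫ x P_m P_n P_L`: the factor `x` is absorbed by `P_m` or by `P_n`. -/
lemma polyIntegral_legendre_triple_recurrence (m n L : ℕ) :
    (2 * n + 1) * ((m + 1) * polyIntegral (legendre (m + 1) * legendre n * legendre L) +
        m * polyIntegral (legendre (m - 1) * legendre n * legendre L)) =
      (2 * m + 1) * ((n + 1) * polyIntegral (legendre m * legendre (n + 1) * legendre L) +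
        n * polyIntegral (legendre m * legendre (n - 1) * legendre L)) := by
  have key (i j : ℕ) : (i + 1) * polyIntegral (legendre (i + 1) * legendre j * legendre L) +
      i * polyIntegral (legendre (i - 1) * legendre j * legendre L) =
      (2 * i + 1) * polyIntegral (X * legendre i * legendre j * legendre L) := by
    have h := congrArg (fun p => polyIntegral (p * (legendre j * legendre L)))
      (legendre_recurrence i)
    simp only [add_mul, mul_assoc, map_add, polyIntegral_natCast_mul] at h
    push_cast at h
    simp only [mul_assoc]
    linarith
  rw [key m n]
  have h := key n m
  rw [show legendre m * legendre (n + 1) = legendre (n + 1) * legendre m by ring,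
    show legendre m * legendre (n - 1) = legendre (n - 1) * legendre m by ring, h,
    show X * legendre n * legendre m = X * legendre m * legendre n by ring]
  ring

/-- Strong induction on `m` with `n` and `L` free, started from orthogonality. A negative `a`, `b`
or `c` encodes failure of the triangle inequality, where `adamsCoeff` supplies the value `0`. -/
lemma polyIntegral_legendre_triple (m : ℕ) : ∀ n L : ℕ,
    (∀ a b c : ℤ, b + c = m → a + c = n → a + b = L →
      polyIntegral (legendre m * legendre n * legendre L) = adamsIntegral a b c) ∧
    (Odd (m + n + L) → polyIntegral (legendre m * legendre n * legendre L) = 0) := by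
  induction m using Nat.strong_induction_on with
  | _ m ih =>
  intro n L
  rcases m with _ | m
  · simp only [legendre_zero, one_mul]
    constructor
    · intro a b c h1 h2 h3
      rcases eq_or_ne n L with rfl | hne
      · obtain rfl : b = 0 := by omega
        obtain rfl : c = 0 := by omega
        obtain rfl : a = n := by omega
        have hp := (adamsCoeff_pos (by omega : (0 : ℤ) ≤ n)).ne'
        have h0 : adamsCoeff 0 = 1 := by simp [adamsCoeff]
        have := int_two_mul_add_one_ne_zero n
        push_cast at this
        rw [polyIntegral_legendre_sq, adamsIntegral, h0]
        simp only [add_zero, Int.cast_natCast, Int.cast_zero, mul_one]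
        field_simp
      · rw [polyIntegral_legendre_mul_of_ne hne, adamsIntegral]
        rcases lt_or_gt_of_ne (by omega : b ≠ 0) with h | h
        · simp [adamsCoeff_of_neg h]
        · simp [adamsCoeff_of_neg (by omega : c < 0)]
    · intro h
      refine polyIntegral_legendre_mul_of_ne ?_
      rintro rfl
      rw [Nat.odd_iff] at h
      omega
  · have hrec := polyIntegral_legendre_triple_recurrence m n L
    have hpos : (2 * (n : ℝ) + 1) * (m + 1) ≠ 0 := by positivity
    constructor
    · intro a b c h1 h2 h3
      have hF := adamsIntegral_recurrence a b c (by omega)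
      -- The prefactor `m` is kept because at `m = 0` the truncated index `m - 1` is meaningless.
      have e1 : (m : ℝ) * polyIntegral (legendre (m - 1) * legendre n * legendre L) =
          m * adamsIntegral (a + 1) (b - 1) (c - 1) := by
        rcases m with _ | m
        · simp
        · rw [Nat.add_sub_cancel,
            ((ih m (by omega)) n L).1 (a + 1) (b - 1) (c - 1) (by omega) (by omega) (by omega)]
      have e2 : (n : ℝ) * polyIntegral (legendre m * legendre (n - 1) * legendre L) =
          n * adamsIntegral a b (c - 1) := by
        rcases n with _ | n
        · simp
        · rw [Nat.add_sub_cancel,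
            ((ih m (by omega)) n L).1 a b (c - 1) (by omega) (by omega) (by omega)]
      have e3 := ((ih m (by omega)) (n + 1) L).1 (a + 1) (b - 1) c (by omega) (by omega) (by omega)
      rw [e1, e2, e3] at hrec
      have hm : (b : ℝ) + c = m + 1 := by exact_mod_cast h1
      have hn : (a : ℝ) + c = n := by exact_mod_cast h2
      rw [hm, hn] at hF
      apply mul_left_cancel₀ hpos
      linear_combination hrec - hF
    · intro hodd
      have e1 : (m : ℝ) * polyIntegral (legendre (m - 1) * legendre n * legendre L) = 0 := by
        rcases m with _ | m
        · simp
        · rw [Nat.add_sub_cancel, ((ih m (by omega)) n L).2 (by grind), mul_zero]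
      have e2 : (n : ℝ) * polyIntegral (legendre m * legendre (n - 1) * legendre L) = 0 := by
        rcases n with _ | n
        · simp
        · rw [Nat.add_sub_cancel, ((ih m (by omega)) n L).2 (by grind), mul_zero]
      have e3 := ((ih m (by omega)) (n + 1) L).2 (by grind)
      rw [e1, e2, e3] at hrec
      apply mul_left_cancel₀ hpos
      linear_combination hrec

/-! ### Squares of associated Legendre functions -/

/-- The polynomial `(l - m)! / (l + m)! P_{lm}²`. -/
def assocSq (l m : ℕ) : ℝ[X] :=
  C (((l - m).factorial : ℝ) / ((l + m).factorial : ℝ)) *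
    ((1 - X ^ 2) ^ m * derivative^[m] (legendre l) ^ 2)

/-- The eigenvalue `(l - m)(l + m + 1)` of the product of the two ladder operators. -/
def ladderCoeff (l m : ℕ) : ℝ := (l - m) * (l + m + 1)

/-- The number of `k ∈ {m, -m}`. -/
def orderMult (m : ℕ) : ℝ := if m = 0 then 1 else 2

lemma C_two : (C 2 : ℝ[X]) = 2 := map_ofNat C 2

lemma C_ladderCoeff_succ (l m : ℕ) :
    C (ladderCoeff l (m + 1)) = C (ladderCoeff l m) - 2 * ((m : ℝ[X]) + 1) := by
  have : ladderCoeff l (m + 1) = ladderCoeff l m - 2 * (m + 1) := by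
    simp only [ladderCoeff]; push_cast; ring
  rw [this]; simp [C_two]

/-- Legendre's equation differentiated `m` times; each differentiation lowers the zeroth-order
coefficient by `2 (m + 1)`. -/
lemma assocLegendre_ode (l m : ℕ) :
    (1 - X ^ 2) * derivative^[m + 2] (legendre l) =
      2 * ((m : ℝ[X]) + 1) * X * derivative^[m + 1] (legendre l) -
        C (ladderCoeff l m) * derivative^[m] (legendre l) := by
  induction m with
  | zero =>
    have h := legendre_ode l
    simp only [derivative_mul, derivative_sub, derivative_X_pow, derivative_one] at h
    simp only [ladderCoeff, Function.iterate_succ_apply', Function.iterate_zero_apply,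
      map_mul, map_add, map_sub, map_natCast, map_one, Nat.cast_zero, map_zero]
    simp only [Nat.cast_ofNat, C_two] at h
    linear_combination -h
  | succ m ih =>
    have h := congrArg derivative ih
    simp only [derivative_mul, derivative_sub, derivative_add, derivative_X_pow, derivative_one,
      derivative_X, derivative_C, derivative_natCast, derivative_ofNat,
      ← Function.iterate_succ_apply' derivative] at h
    rw [C_ladderCoeff_succ]
    simp only [Nat.cast_ofNat, C_two, Nat.succ_eq_add_one] at h
    push_cast
    linear_combination h

lemma ladderCoeff_self (l : ℕ) : ladderCoeff l l = 0 := by simp [ladderCoeff]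

lemma ladderCoeff_pos {l m : ℕ} (h : m < l) : 0 < ladderCoeff l m := by
  have : (m : ℝ) < l := by exact_mod_cast h
  exact mul_pos (by linarith) (by positivity)

lemma ladderCoeff_mul_factorial_div {l m : ℕ} (h : m < l) :
    ladderCoeff l m * (((l - (m + 1)).factorial : ℝ) / ((l + (m + 1)).factorial : ℝ)) =
      ((l - m).factorial : ℝ) / ((l + m).factorial : ℝ) := by
  have h1 : l - m = l - (m + 1) + 1 := by omega
  have h2 : ((l - (m + 1) : ℕ) : ℝ) + 1 = l - m := by
    rw [Nat.cast_sub (by omega)]; push_cast; ring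
  rw [h1, ← add_assoc, Nat.factorial_succ (l - (m + 1)), Nat.factorial_succ (l + m), ladderCoeff]
  push_cast
  rw [h2]
  have h3 : ((l + m).factorial : ℝ) ≠ 0 := by positivity
  have h4 : ((l : ℝ) + m + 1) ≠ 0 := by positivity
  field_simp

lemma iterate_derivative_legendre_succ (l : ℕ) : derivative^[l + 1] (legendre l) = 0 :=
  iterate_derivative_eq_zero_of_degree_lt (by
    rw [degree_legendre]; exact_mod_cast Nat.lt_succ_self l)

/-- Trades the normalization of order `m + 1` for that of order `m`. At `m = l` the truncated `l -
(m + 1)` does not matter, since both sides vanish. -/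
lemma ladderCoeff_mul_assocSq_succ {l m : ℕ} (h : m ≤ l) :
    C (ladderCoeff l m) * assocSq l (m + 1) =
      C (((l - m).factorial : ℝ) / ((l + m).factorial : ℝ)) *
        ((1 - X ^ 2) ^ (m + 1) * derivative^[m + 1] (legendre l) ^ 2) := by
  rcases h.lt_or_eq with h | rfl
  · rw [assocSq, ← mul_assoc, ← C_mul, ladderCoeff_mul_factorial_div h]
  · simp [ladderCoeff_self, iterate_derivative_legendre_succ]

/-- The relation `legendreOp_assocSq_succ` continued to order `0`: under `m ↦ -m` the two neighbours
coincide, whence the factor `2`. -/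
lemma legendreOp_assocSq_zero (l : ℕ) :
    legendreOp (assocSq l 0) = -(2 * (C (ladderCoeff l 0) * (assocSq l 1 - assocSq l 0))) := by
  have h1 := ladderCoeff_mul_assocSq_succ (Nat.zero_le l)
  have h2 := assocLegendre_ode l 0
  have hf : ((l.factorial : ℝ) / l.factorial) = 1 := div_self (by positivity)
  simp only [Nat.sub_zero, Nat.add_zero, hf, map_one, one_mul, pow_one,
    Function.iterate_succ_apply', Function.iterate_zero_apply, CharP.cast_eq_zero,
    zero_add] at h1 h2
  rw [mul_sub, h1]
  simp only [legendreOp_apply, assocSq, Nat.sub_zero, Nat.add_zero, hf, map_one, one_mul, pow_zero,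
    Function.iterate_zero_apply, derivative_mul, derivative_sub, derivative_one,
    derivative_pow, derivative_X, derivative_C]
  simp only [Nat.cast_ofNat, C_two, Nat.cast_one, map_one, Nat.add_one_sub_one, pow_one]
  linear_combination (-2 * legendre l) * h2

/-- The differential operator in `t` becomes minus a discrete Sturm–Liouville operator in the order
`m`, with conductances `ladderCoeff`. The product rule followed by the differential equations of
orders `m` and `m + 1` gives this. -/
lemma legendreOp_assocSq_succ {l m : ℕ} (h : m < l) :
    legendreOp (assocSq l (m + 1)) =
      -(C (ladderCoeff l (m + 1)) * (assocSq l (m + 2) - assocSq l (m + 1)) -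
        C (ladderCoeff l m) * (assocSq l (m + 1) - assocSq l m)) := by
  have h1 := ladderCoeff_mul_assocSq_succ (Nat.succ_le_of_lt h)
  have e1 := assocLegendre_ode l m
  have e2 := assocLegendre_ode l (m + 1)
  -- All three orders are brought to the normalizing constant of order `m + 1`.
  have h0 : assocSq l m = C (ladderCoeff l m) *
      (C (((l - (m + 1)).factorial : ℝ) / ((l + (m + 1)).factorial : ℝ)) *
      ((1 - X ^ 2) ^ m * derivative^[m] (legendre l) ^ 2)) := by
    rw [assocSq, ← ladderCoeff_mul_factorial_div h, C_mul]; ring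
  have hd : derivative (derivative^[m + 1] (legendre l)) = derivative^[m + 2] (legendre l) :=
    (Function.iterate_succ_apply' derivative _ _).symm
  have hd2 : derivative (derivative^[m + 2] (legendre l)) = derivative^[m + 3] (legendre l) :=
    (Function.iterate_succ_apply' derivative _ _).symm
  simp only [mul_sub, Nat.succ_eq_add_one] at h1 ⊢
  rw [h1, h0]
  simp only [assocSq]
  rw [C_ladderCoeff_succ] at e2 ⊢
  generalize ((l - (m + 1)).factorial : ℝ) / ((l + (m + 1)).factorial : ℝ) = c
  rw [show m + 1 + 2 = m + 3 from rfl, show m + 1 + 1 = m + 2 from rfl] at e2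
  set y0 := derivative^[m] (legendre l)
  set y1 := derivative^[m + 1] (legendre l)
  set y2 := derivative^[m + 2] (legendre l)
  set y3 := derivative^[m + 3] (legendre l)
  have hv (n : ℕ) : derivative ((1 - X ^ 2 : ℝ[X]) ^ (n + 1)) =
      -(2 * ((n : ℝ[X]) + 1) * X * (1 - X ^ 2) ^ n) := by
    simp only [derivative_pow_succ, derivative_sub, derivative_one, derivative_X, C_add, C_1,
      map_natCast, pow_one]
    ring
  have hp : (X ^ 2 - 1) * derivative (C c * ((1 - X ^ 2) ^ (m + 1) * y1 ^ 2)) =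
      C c * ((1 - X ^ 2) ^ (m + 1) *
        (2 * ((m : ℝ[X]) + 1) * X * y1 ^ 2 - 2 * (1 - X ^ 2) * y1 * y2)) := by
    rw [derivative_C_mul, derivative_mul, hv, derivative_pow_succ, hd]
    simp only [C_add, C_1, pow_one, Nat.cast_one]
    ring
  rw [legendreOp_apply, hp]
  simp only [derivative_C, derivative_mul, hv, derivative_pow_succ, hd, hd2, derivative_sub,
    derivative_add, derivative_X, derivative_one, derivative_natCast, derivative_ofNat, pow_one,
    C_add, C_1, Nat.cast_one]
  push_cast at e2
  linear_combination (-2 * C c * (1 - X ^ 2) ^ (m + 1) * y1) * e2 +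
    C c * (1 - X ^ 2) ^ m * (C (ladderCoeff l m) * y0 +
      (2 * ((m : ℝ[X]) + 1) * X * y1 - (1 - X ^ 2) * y2)) * e1

lemma eval_one_assocSq_zero (l : ℕ) : (assocSq l 0).eval 1 = 1 := by
  have hf : (l.factorial : ℝ) ≠ 0 := by positivity
  simp [assocSq, hf]

lemma eval_one_assocSq_succ (l m : ℕ) : (assocSq l (m + 1)).eval 1 = 0 := by
  simp [assocSq]

lemma assocSq_zero (l : ℕ) : assocSq l 0 = legendre l ^ 2 := by
  have hf : (l.factorial : ℝ) ≠ 0 := by positivity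
  simp [assocSq, hf]

lemma eval_assocSq_nonneg (l m : ℕ) {t : ℝ} (ht : t ∈ Set.Icc (-1 : ℝ) 1) :
    0 ≤ (assocSq l m).eval t := by
  have : 0 ≤ 1 - t ^ 2 := by nlinarith [ht.1, ht.2]
  simp only [assocSq, eval_mul, eval_C, eval_pow, eval_sub, eval_one, eval_X]
  positivity

lemma natDegree_assocSq_le {l m : ℕ} (hm : m ≤ l) : (assocSq l m).natDegree ≤ 2 * l := by
  have h1 : (1 - X ^ 2 : ℝ[X]).natDegree ≤ 2 := by compute_degree
  have h2 : (derivative^[m] (legendre l)).natDegree ≤ l - m := by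
    refine (natDegree_iterate_derivative _ _).trans ?_
    rw [natDegree_eq_of_degree_eq_some (degree_legendre l)]
  refine (natDegree_C_mul_le _ _).trans (natDegree_mul_le.trans ?_)
  have h3 := natDegree_pow_le_of_le m h1
  have h4 := natDegree_pow_le_of_le 2 h2
  omega

/-- Summation by parts for the tridiagonal action of `legendreOp` on the `assocSq l m`. -/
lemma sum_legendreOp_assocSq (l : ℕ) (c d : ℕ → ℝ)
    (hd0 : d 0 = -(2 * (ladderCoeff l 0 * (c 1 - c 0))))
    (hd : ∀ m < l, d (m + 1) = -(ladderCoeff l (m + 1) * (c (m + 2) - c (m + 1)) -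
      ladderCoeff l m * (c (m + 1) - c m))) :
    ∑ m ∈ Finset.range (l + 1), C (orderMult m) *
      (C (c m) * legendreOp (assocSq l m) - C (d m) * assocSq l m) = 0 := by
  -- Discrete Green's identity: a partial sum equals its boundary term at `M`, which vanishes at `M
  -- = l` because `ladderCoeff l l = 0`.
  have h : ∀ M ≤ l, ∑ m ∈ Finset.range (M + 1), C (orderMult m) *
      (C (c m) * legendreOp (assocSq l m) - C (d m) * assocSq l m) =
      -(2 * (C (ladderCoeff l M) *
        (C (c M) * assocSq l (M + 1) - C (c (M + 1)) * assocSq l M))) := by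
    intro M
    induction M with
    | zero =>
      intro _
      simp only [zero_add, Finset.sum_range_one, legendreOp_assocSq_zero, hd0, orderMult,
        if_true, C_1, C_neg, C_mul, C_sub, C_two]
      ring
    | succ M ih =>
      intro hM
      rw [Finset.sum_range_succ, ih (by omega), legendreOp_assocSq_succ (by omega),
        hd M (by omega)]
      simp only [orderMult, if_neg (Nat.succ_ne_zero M), C_neg, C_mul, C_sub, C_two]
      ring
  rw [h l le_rfl, ladderCoeff_self]; simp

/-- Unsöld's theorem. -/
lemma sum_assocSq (l : ℕ) :
    ∑ m ∈ Finset.range (l + 1), C (orderMult m) * assocSq l m = 1 := by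
  -- Sequences constant in `m` are annihilated by the discrete operator, so the sum has eigenvalue
  -- `0` and is constant. At `t = 1` only order `0` survives.
  have h := sum_legendreOp_assocSq l (fun _ => 1) (fun _ => 0) (by simp) (by simp)
  simp only [C_1, one_mul, C_0, zero_mul, sub_zero] at h
  have h2 : legendreOp (∑ m ∈ Finset.range (l + 1), C (orderMult m) * assocSq l m) =
      C (((0 : ℕ) : ℝ) * ((0 : ℕ) + 1)) *
        ∑ m ∈ Finset.range (l + 1), C (orderMult m) * assocSq l m := by
    simp only [← smul_eq_C_mul, map_sum, map_smul] at h ⊢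
    rw [h]; simp
  rw [eq_legendre_of_eigen h2, eval_finsetSum, Finset.sum_range_succ']
  simp [eval_one_assocSq_succ, eval_one_assocSq_zero, orderMult]

/-- The integral of `legendreOp` of anything vanishes, so the discrete flux between orders `m` and
`m + 1` is zero for all `m`, starting at the reflecting end `m = 0`. Positive conductances make the
integral independent of `m`. -/
lemma polyIntegral_assocSq {l m : ℕ} (hm : m ≤ l) :
    polyIntegral (assocSq l m) = 2 / (2 * l + 1) := by
  have h : ∀ m ≤ l,
      ladderCoeff l m * (polyIntegral (assocSq l (m + 1)) - polyIntegral (assocSq l m)) = 0 := by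
    intro m
    induction m with
    | zero =>
      intro _
      have h := polyIntegral_legendreOp (assocSq l 0)
      rw [legendreOp_assocSq_zero, ← C_two, map_neg, polyIntegral_C_mul, polyIntegral_C_mul,
        map_sub] at h
      simp only [zero_add]
      linarith
    | succ m ih =>
      intro hm
      have h := polyIntegral_legendreOp (assocSq l (m + 1))
      rw [legendreOp_assocSq_succ (by omega), map_neg, map_sub, polyIntegral_C_mul,
        polyIntegral_C_mul, map_sub, map_sub] at h
      linarith [ih (by omega)]
  induction m with
  | zero => rw [assocSq_zero, sq, polyIntegral_legendre_sq]
  | succ m ih =>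
    have h1 := (mul_eq_zero.mp (h m (by omega))).resolve_left (ladderCoeff_pos hm).ne'
    rw [← ih (by omega)]
    linarith

/-- By self-adjointness the numbers `∫ q_m P_L` form an eigensequence of the discrete operator with
eigenvalue `L (L + 1)`. Summation by parts carries this eigenvalue to the sum, which is therefore a
multiple of `P_L`; the factor is its value at `1`, the term of order `0`. -/
lemma sum_polyIntegral_assocSq (l L : ℕ) :
    ∑ m ∈ Finset.range (l + 1),
      C (orderMult m) * (C (polyIntegral (assocSq l m * legendre L)) * assocSq l m) =
    C (polyIntegral (legendre l * legendre l * legendre L)) * legendre L := by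
  set c : ℕ → ℝ := fun m => polyIntegral (assocSq l m * legendre L) with hc
  have hd (m : ℕ) : (L * (L + 1) : ℝ) * c m =
      polyIntegral (legendreOp (assocSq l m) * legendre L) := by
    rw [polyIntegral_legendreOp_mul, legendreOp_legendre, mul_left_comm, polyIntegral_C_mul]
  have h := sum_legendreOp_assocSq l c (fun m => (L * (L + 1) : ℝ) * c m) (by
      rw [hd, legendreOp_assocSq_zero, ← C_two, neg_mul, map_neg, mul_assoc, mul_assoc,
        polyIntegral_C_mul, polyIntegral_C_mul, sub_mul, map_sub]) (by
      intro m hm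
      rw [hd, legendreOp_assocSq_succ hm, neg_mul, map_neg, sub_mul, mul_assoc, mul_assoc, map_sub,
        polyIntegral_C_mul, polyIntegral_C_mul, sub_mul, sub_mul, map_sub, map_sub])
  have h2 : legendreOp (∑ m ∈ Finset.range (l + 1), C (orderMult m) * (C (c m) * assocSq l m)) =
      C (L * (L + 1) : ℝ) *
        ∑ m ∈ Finset.range (l + 1), C (orderMult m) * (C (c m) * assocSq l m) := by
    rw [← sub_eq_zero, ← h, Finset.mul_sum, map_sum, ← Finset.sum_sub_distrib]
    refine Finset.sum_congr rfl fun m _ => ?_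
    simp only [← smul_eq_C_mul, map_smul]
    simp only [smul_eq_C_mul, C_mul]
    ring
  rw [eq_legendre_of_eigen h2, eval_finsetSum, Finset.sum_range_succ']
  simp [eval_one_assocSq_succ, orderMult, hc, assocSq_zero, sq]

/-- Parseval's identity behind the addition theorem: the quadratic form with kernel `P_l²` on
zonal functions, in the bases `P_{lm}²` and `P_L`. -/
lemma sum_sq_assocSq (Λ : ℝ[X] →ₗ[ℝ] ℝ) (l : ℕ) :
    ∑ m ∈ Finset.range (l + 1), orderMult m * Λ (assocSq l m) ^ 2 =
      ∑ L ∈ Finset.range (2 * l + 1),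
        (2 * L + 1) / 2 * polyIntegral (legendre l * legendre l * legendre L) *
          Λ (legendre L) ^ 2 := by
  have h1 (L : ℕ) : (2 * L + 1) / 2 * polyIntegral (legendre l * legendre l * legendre L) *
      Λ (legendre L) ^ 2 = ∑ m ∈ Finset.range (l + 1), orderMult m * (Λ (assocSq l m) *
        ((2 * L + 1) / 2 * polyIntegral (assocSq l m * legendre L) * Λ (legendre L))) := by
    have h := congrArg Λ (sum_polyIntegral_assocSq l L)
    simp only [← smul_eq_C_mul, map_sum, map_smul, smul_eq_mul] at h
    calc _ = (2 * L + 1) / 2 * Λ (legendre L) *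
        (polyIntegral (legendre l * legendre l * legendre L) * Λ (legendre L)) := by ring
      _ = _ := by
        rw [← h, Finset.mul_sum]
        exact Finset.sum_congr rfl fun m _ => by ring
  simp only [h1]
  rw [Finset.sum_comm]
  refine Finset.sum_congr rfl fun m hm => ?_
  rw [← Finset.mul_sum, ← Finset.mul_sum, sq]
  congr 2
  -- Only one of the two factors `Λ (assocSq l m)` is expanded in Legendre polynomials.
  conv_lhs => rw [legendre_expansion (assocSq l m)
    (natDegree_assocSq_le (by simpa [Nat.lt_succ_iff] using hm))]
  simp only [← smul_eq_C_mul, map_sum, map_smul, smul_eq_mul]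

end

/-! ### Dixon's identity and the coefficients `C_{l0l0}^{L0}` -/

lemma invFactorial_natCast (n : ℕ) : invFactorial n = (n.factorial : ℝ)⁻¹ := by
  simp [invFactorial]

lemma invFactorial_of_neg {n : ℤ} (hn : n < 0) : invFactorial n = 0 := if_neg (by omega)

lemma invFactorial_succ (n : ℤ) : (n + 1) * invFactorial (n + 1) = invFactorial n := by
  rcases lt_trichotomy n (-1) with h | rfl | h
  · rw [invFactorial_of_neg (by omega), invFactorial_of_neg (by omega)]; simp
  · rw [invFactorial_of_neg (by omega : (-1 : ℤ) < 0)]; simp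
  · lift n to ℕ using by omega
    rw [show (n : ℤ) + 1 = ((n + 1 : ℕ) : ℤ) by push_cast; rfl, invFactorial_natCast,
      invFactorial_natCast, Nat.factorial_succ]
    push_cast
    have : (n.factorial : ℝ) ≠ 0 := by positivity
    have : (n : ℝ) + 1 ≠ 0 := by positivity
    field_simp

/-- The summand of Dixon's sum. -/
def dixonTerm (a b k : ℤ) : ℝ :=
  (-1) ^ k * (invFactorial (a + k) * invFactorial (a - k) *
    (invFactorial (b + k) * invFactorial (b - k)) ^ 2)

/-- The certificate for the recurrence of Dixon's sum in `a`. -/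
def dixonCertificate (a b k : ℤ) : ℝ :=
  -(1 / 2) * ((-1) ^ k * (invFactorial (a + k) * invFactorial (a + 1 - k) *
    (invFactorial (b + k - 1) * invFactorial (b - k)) ^ 2))

/-- Creative telescoping. Every reciprocal factorial is rewritten by `invFactorial_succ`, valid at
all integers, so no boundary cases arise and the identity becomes polynomial. -/
lemma dixonTerm_recurrence (a b k : ℤ) :
    (a + 1) * (a + b + 1) ^ 2 * dixonTerm (a + 1) b k - (a + 2 * b + 1) * dixonTerm a b k =
      dixonCertificate a b (k + 1) - dixonCertificate a b k := by
  have h1 := invFactorial_succ (a + k)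
  have h2 := invFactorial_succ (a - k)
  have h3 := invFactorial_succ (b + k - 1)
  have h4 := invFactorial_succ (b - k - 1)
  rw [show a + k + 1 = a + 1 + k by ring] at h1
  rw [show a - k + 1 = a + 1 - k by ring] at h2
  rw [show b + k - 1 + 1 = b + k by ring] at h3
  rw [show b - k - 1 + 1 = b - k by ring] at h4
  push_cast at h1 h2 h3 h4
  simp only [dixonTerm, dixonCertificate, show a + 1 - (k + 1) = a - k by ring,
    show a + (k + 1) = a + 1 + k by ring, show b + (k + 1) - 1 = b + k by ring,
    show b - (k + 1) = b - k - 1 by ring]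
  rw [← h1, ← h2, ← h3, ← h4, zpow_add_one₀ (by norm_num)]
  ring

lemma dixonTerm_eq_zero {a b k : ℤ} (h : k ∉ Finset.Icc (-a) a) : dixonTerm a b k = 0 := by
  rw [Finset.mem_Icc, not_and_or] at h
  rcases h with h | h
  · simp [dixonTerm, invFactorial_of_neg (by omega : a + k < 0)]
  · simp [dixonTerm, invFactorial_of_neg (by omega : a - k < 0)]

lemma summable_dixonTerm (a b : ℤ) : Summable (dixonTerm a b) :=
  summable_of_ne_finset_zero (s := Finset.Icc (-a) a) fun _ h => dixonTerm_eq_zero h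

lemma summable_dixonCertificate (a b : ℤ) : Summable (dixonCertificate a b) := by
  refine summable_of_ne_finset_zero (s := Finset.Icc (-a) (a + 1)) fun k h => ?_
  rw [Finset.mem_Icc, not_and_or] at h
  rcases h with h | h
  · simp [dixonCertificate, invFactorial_of_neg (by omega : a + k < 0)]
  · simp [dixonCertificate, invFactorial_of_neg (by omega : a + 1 - k < 0)]

/-- Summing over all of `ℤ` cancels the certificate by translation invariance. -/
lemma tsum_dixonTerm_succ (a b : ℤ) :
    (a + 1) * (a + b + 1) ^ 2 * ∑' k, dixonTerm (a + 1) b k =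
      (a + 2 * b + 1) * ∑' k, dixonTerm a b k := by
  have h : ∑' k, ((a + 1) * (a + b + 1) ^ 2 * dixonTerm (a + 1) b k -
      (a + 2 * b + 1) * dixonTerm a b k) =
      ∑' k, (dixonCertificate a b (k + 1) - dixonCertificate a b k) :=
    tsum_congr (dixonTerm_recurrence a b)
  have hs : Summable fun k => dixonCertificate a b (k + 1) :=
    (Equiv.addRight (1 : ℤ)).summable_iff.mpr (summable_dixonCertificate a b)
  have he : ∑' k, dixonCertificate a b (k + 1) = ∑' k, dixonCertificate a b k :=
    (Equiv.addRight (1 : ℤ)).tsum_eq (dixonCertificate a b)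
  rw [((summable_dixonTerm _ b).mul_left _).tsum_sub ((summable_dixonTerm a b).mul_left _),
    hs.tsum_sub (summable_dixonCertificate a b), he, sub_self, tsum_mul_left, tsum_mul_left] at h
  linarith

/-- Dixon's identity with two equal parameters. -/
lemma tsum_dixonTerm (a b : ℕ) :
    ∑' k, dixonTerm a b k = ((a + 2 * b).factorial : ℝ) /
      (a.factorial * b.factorial ^ 2 * (a + b).factorial ^ 2 * (2 * b).factorial) := by
  induction a with
  | zero =>
    rw [tsum_eq_single 0 (fun k hk => dixonTerm_eq_zero (by
      rw [Finset.mem_Icc]; push_cast; omega))]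
    have h0 : invFactorial 0 = 1 := by simp [invFactorial]
    simp only [dixonTerm, Nat.cast_zero, add_zero, sub_zero, h0, invFactorial_natCast, zero_add,
      Nat.factorial_zero, zpow_zero]
    have : (b.factorial : ℝ) ≠ 0 := by positivity
    have : ((2 * b).factorial : ℝ) ≠ 0 := by positivity
    push_cast
    field_simp
  | succ a ih =>
    have h := tsum_dixonTerm_succ a b
    rw [ih] at h
    rw [show a + 1 + 2 * b = (a + 2 * b) + 1 by ring, show a + 1 + b = (a + b) + 1 by ring,
      Nat.factorial_succ a, Nat.factorial_succ (a + b), Nat.factorial_succ (a + 2 * b)]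
    push_cast at h ⊢
    have h1 : (a.factorial : ℝ) ≠ 0 := by positivity
    have h2 : (b.factorial : ℝ) ≠ 0 := by positivity
    have h3 : ((a + b).factorial : ℝ) ≠ 0 := by positivity
    have h4 : ((2 * b).factorial : ℝ) ≠ 0 := by positivity
    have h5 : (a : ℝ) + 1 ≠ 0 := by positivity
    have h6 : (a : ℝ) + b + 1 ≠ 0 := by positivity
    apply mul_left_cancel₀ (mul_ne_zero h5 (pow_ne_zero 2 h6))
    rw [h]
    field_simp

/-- The sum in the Racah formula for `C_{l0l0}^{L0}`. -/
def racahSum (l L : ℕ) : ℝ :=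
  ∑ z ∈ Finset.range (l + l + 1), (-1 : ℝ) ^ z *
    (invFactorial z * invFactorial (l + l - L - z) * invFactorial (l - 0 - z) *
      invFactorial (l + 0 - z) * invFactorial (L - l + 0 + z) * invFactorial (L - l - 0 + z))

/-- Terms beyond `n = 2l - L` vanish, and the reflection `z ↦ n - z` preserves the factorials but
reverses the sign, as `n` is odd. -/
lemma racahSum_of_odd {l L : ℕ} (hL : L ≤ l + l) (h : Odd L) : racahSum l L = 0 := by
  obtain ⟨n, hn⟩ : ∃ n, l + l = n + L := ⟨l + l - L, by omega⟩
  have hodd : Odd n := by grind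
  have h1 : racahSum l L = ∑ z ∈ Finset.range (n + 1), (-1 : ℝ) ^ z *
    (invFactorial z * invFactorial (l + l - L - z) * invFactorial (l - 0 - z) *
      invFactorial (l + 0 - z) * invFactorial (L - l + 0 + z) * invFactorial (L - l - 0 + z)) := by
    refine (Finset.sum_subset (Finset.range_subset_range.mpr (by omega)) fun z _ hz => ?_).symm
    rw [Finset.mem_range, not_lt] at hz
    simp [invFactorial_of_neg (by omega : (l : ℤ) + l - L - z < 0)]
  have h2 := h1
  rw [← Finset.sum_range_reflect] at h2
  have h3 : racahSum l L = -racahSum l L := by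
    conv_rhs => rw [h1]
    rw [h2, ← Finset.sum_neg_distrib]
    refine Finset.sum_congr rfl fun z hz => ?_
    rw [Finset.mem_range] at hz
    obtain ⟨y, hy⟩ : ∃ y, n = y + z := ⟨n - z, by omega⟩
    have hs : (-1 : ℝ) ^ y = -(-1) ^ z := by
      have : (-1 : ℝ) ^ y * (-1) ^ z = -1 := by rw [← pow_add, ← hy, hodd.neg_one_pow]
      rcases neg_one_pow_eq_or ℝ z with h | h <;> rw [h] at this ⊢ <;> linarith
    rw [show n + 1 - 1 - z = y by omega, hs, show (l : ℤ) + l - L - y = z by omega,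
      show (l : ℤ) - 0 - y = L - l + 0 + z by omega, show (l : ℤ) + 0 - y = L - l + 0 + z by omega,
      show (L : ℤ) - l + 0 + y = l - 0 - z by omega, show (L : ℤ) - l - 0 + y = l - 0 - z by omega,
      show (l : ℤ) + l - L - z = y by omega, show (l : ℤ) + 0 - z = l - 0 - z by omega,
      show (L : ℤ) - l - 0 + z = L - l + 0 + z by omega]
    ring
  linarith

/-- The shift `k = z - a` turns the Racah summand into Dixon's, up to `(-1) ^ a`. -/
lemma racahSum_of_even (a b : ℕ) :
    racahSum (a + b) (2 * b) = (-1) ^ a * (((a + 2 * b).factorial : ℝ) /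
      (a.factorial * b.factorial ^ 2 * (a + b).factorial ^ 2 * (2 * b).factorial)) := by
  rw [← tsum_dixonTerm, tsum_eq_sum (s := (Finset.range ((a + b) + (a + b) + 1)).image
      fun z : ℕ => (z : ℤ) - a), Finset.sum_image (by intro x _ y _ h; simpa using h), racahSum,
    Finset.mul_sum]
  · refine Finset.sum_congr rfl fun z _ => ?_
    have hz : (-1 : ℝ) ^ ((z : ℤ) - a) * (-1) ^ a = (-1) ^ z := by
      rw [← zpow_natCast (-1 : ℝ) a, ← zpow_add₀ (by norm_num), sub_add_cancel, zpow_natCast]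
    rw [dixonTerm, ← hz]
    push_cast
    rw [show (a : ℤ) + (z - a) = z by ring,
      show (a : ℤ) + b + (a + b) - 2 * b - z = a - (z - a) by ring,
      show (a : ℤ) + b - 0 - z = b - (z - a) by ring,
      show (a : ℤ) + b + 0 - z = b - (z - a) by ring,
      show 2 * (b : ℤ) - (a + b) + 0 + z = b + (z - a) by ring,
      show 2 * (b : ℤ) - (a + b) - 0 + z = b + (z - a) by ring]
    ring
  · intro k hk
    refine dixonTerm_eq_zero fun hk' => hk ?_
    rw [Finset.mem_Icc] at hk'
    rw [Finset.mem_image]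
    refine ⟨(k + a).toNat, ?_, ?_⟩
    · rw [Finset.mem_range]; omega
    · omega

lemma adamsCoeff_eq_factorial (r : ℕ) :
    adamsCoeff r = ((2 * r).factorial : ℝ) / (2 ^ r * r.factorial ^ 2) := by
  rw [adamsCoeff_natCast, Nat.centralBinom_eq_two_mul_choose, Nat.cast_choose ℝ (by omega),
    show 2 * r - r = r by omega]
  have : (r.factorial : ℝ) ≠ 0 := by positivity
  field_simp

lemma clebschGordan_of_lt {l L : ℕ} (h : 2 * l < L) : clebschGordan l 0 l 0 L 0 = 0 :=
  if_neg (by omega)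

/-- For `L = 2b`, `l = a + b`, Adams' formula with parameters `(b, b, a)` and Dixon's identity make
both sides explicit factorial quotients. For odd `L` both sides vanish by parity. -/
lemma clebschGordan_sq {l L : ℕ} (h : L ≤ 2 * l) :
    clebschGordan l 0 l 0 L 0 ^ 2 =
      (2 * L + 1) / 2 * polyIntegral (legendre l * legendre l * legendre L) := by
  have h0 : clebschGordan l 0 l 0 L 0 = Real.sqrt ((2 * L + 1) *
        (intFactorial (l + l - L) * intFactorial (l - l + L) *
          intFactorial (-l + l + L)) / intFactorial (l + l + L + 1)) *
      Real.sqrt (intFactorial (l + 0) * intFactorial (l - 0) *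
        (intFactorial (l + 0) * intFactorial (l - 0)) *
        (intFactorial (L + 0) * intFactorial (L - 0))) * racahSum l L := by
    rw [clebschGordan, if_pos (by simp; omega)]
    rfl
  have hi (n : ℤ) : 0 ≤ intFactorial n := by simp [intFactorial]
  have hin (n : ℕ) : intFactorial n = n.factorial := by simp [intFactorial]
  rw [h0, mul_pow, mul_pow, Real.sq_sqrt, Real.sq_sqrt]
  rotate_left
  · have := hi (l + 0); have := hi (l - 0); have := hi (L + 0); have := hi (L - 0)
    positivity
  · have := hi (l + l - L); have := hi (l - l + L); have := hi (-l + l + L)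
    have := hi (l + l + L + 1)
    positivity
  rcases Nat.even_or_odd L with hL | hL
  · obtain ⟨b, rfl⟩ := hL.two_dvd
    obtain ⟨a, rfl⟩ : ∃ a, l = a + b := ⟨l - b, by omega⟩
    rw [(polyIntegral_legendre_triple (a + b) (a + b) (2 * b)).1 b b a (by push_cast; ring)
      (by push_cast; ring) (by push_cast; ring), adamsIntegral, racahSum_of_even, mul_pow,
      ← pow_mul,
      mul_comm a 2, pow_mul, neg_one_sq, one_pow, one_mul]
    rw [show ((a + b : ℕ) : ℤ) + (a + b : ℕ) - (2 * b : ℕ) = (2 * a : ℕ) by push_cast; ring,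
      show ((a + b : ℕ) : ℤ) - (a + b : ℕ) + (2 * b : ℕ) = (2 * b : ℕ) by push_cast; ring,
      show -((a + b : ℕ) : ℤ) + (a + b : ℕ) + (2 * b : ℕ) = (2 * b : ℕ) by push_cast; ring,
      show ((a + b : ℕ) : ℤ) + (a + b : ℕ) + (2 * b : ℕ) + 1 = (2 * (a + 2 * b) + 1 : ℕ) by
        push_cast; ring, show (b : ℤ) + b + a = (a + 2 * b : ℕ) by push_cast; ring]
    simp only [add_zero, sub_zero, hin, adamsCoeff_eq_factorial, Nat.factorial_succ]
    have h1 : (a.factorial : ℝ) ≠ 0 := by positivity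
    have h2 : (b.factorial : ℝ) ≠ 0 := by positivity
    have h3 : ((a + b).factorial : ℝ) ≠ 0 := by positivity
    have h4 : ((2 * b).factorial : ℝ) ≠ 0 := by positivity
    have h5 : ((a + 2 * b).factorial : ℝ) ≠ 0 := by positivity
    have h6 : ((2 * (a + 2 * b)).factorial : ℝ) ≠ 0 := by positivity
    have h7 : (2 * (a + 2 * b) + 1 : ℝ) ≠ 0 := by positivity
    push_cast
    rw [show (2 * ((b : ℝ) + b + a) + 1) = 2 * (a + 2 * b) + 1 by ring, pow_add]
    field_simp
    ring
  · rw [(polyIntegral_legendre_triple l l L).2 (by grind), racahSum_of_odd (by omega) hL]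
    simp

section

open scoped ENNReal Pointwise

/-! ### Archimedes' theorem: the law of the height and the longitude -/

/-- The height and the longitude of a point of the sphere. -/
def cylinderCoord (x : Sphere2) : ℝ × ℝ := (x.1 2, longitude x)

lemma measurable_cylinderCoord : Measurable cylinderCoord := by
  have h (i : Fin 3) : Measurable fun x : Sphere2 => x.1 i := by fun_prop
  refine (h 2).prodMk (Complex.measurable_arg.comp ?_)
  exact (Complex.measurableEquivRealProd.symm.measurable.comp ((h 0).prodMk (h 1)))

/-- The identification of `ℝ³` with `ℝ × ℂ`, the last coordinate coming first. -/
def splitLast : EuclideanSpace ℝ (Fin 3) ≃ᵐ ℝ × ℂ :=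
  ((MeasurableEquiv.toLp 2 (Fin 3 → ℝ)).symm.trans
    (MeasurableEquiv.piFinSuccAbove (fun _ => ℝ) 2)).trans
    ((MeasurableEquiv.refl ℝ).prodCongr Complex.measurableEquivPi.symm)

lemma splitLast_apply (y : EuclideanSpace ℝ (Fin 3)) :
    splitLast y = (y 2, (⟨y 0, y 1⟩ : ℂ)) := by
  refine Prod.ext rfl ?_
  change Complex.measurableEquivPi.symm _ = _
  rw [Complex.measurableEquivPi_symm_apply]
  apply Complex.ext
  · simp [Fin.removeNth]
  · simp [Fin.removeNth]
    rfl

lemma measurePreserving_splitLast : MeasurePreserving splitLast := by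
  refine MeasurePreserving.trans (MeasurePreserving.trans
    (EuclideanSpace.volume_preserving_symm_measurableEquiv_toLp (Fin 3))
    (volume_preserving_piFinSuccAbove (fun _ => ℝ) 2)) ?_
  exact (MeasurePreserving.id _).prod Complex.volume_preserving_equiv_pi.symm

lemma lintegral_Ioi_mul_Ioo {f : ℝ → ℝ≥0∞} {g : ℝ → ℝ≥0∞} (hf : Measurable f) (hg : Measurable g) :
    ∫⁻ p in polarCoord.target, f p.1 * g p.2 =
      (∫⁻ ρ in Set.Ioi 0, f ρ) * ∫⁻ φ in Set.Ioo (-Real.pi) Real.pi, g φ := by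
  rw [polarCoord_target, Measure.volume_eq_prod, ← Measure.prod_restrict,
    lintegral_prod_mul hf.aemeasurable hg.aemeasurable]

/-- The meridian section of the cone over the set of points with height in `A`. -/
def coneSection (A : Set ℝ) : Set (ℝ × ℝ) :=
  {p | 0 < p.1 ^ 2 + p.2 ^ 2 ∧ p.1 ^ 2 + p.2 ^ 2 < 1 ∧ p.1 / Real.sqrt (p.1 ^ 2 + p.2 ^ 2) ∈ A}

lemma measurableSet_coneSection {A : Set ℝ} (hA : MeasurableSet A) :
    MeasurableSet (coneSection A) := by
  have h : Measurable fun p : ℝ × ℝ => p.1 ^ 2 + p.2 ^ 2 := by fun_prop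
  exact (measurableSet_lt measurable_const h).inter ((measurableSet_lt h measurable_const).inter
    (hA.preimage (measurable_fst.div h.sqrt)))

lemma lintegral_sin_Ioo {A : Set ℝ} (hA : MeasurableSet A) :
    ∫⁻ θ in Set.Ioo 0 Real.pi, ENNReal.ofReal (Real.sin θ) * A.indicator 1 (Real.cos θ) =
      volume (A ∩ Set.Ioo (-1) 1) := by
  have himg : Real.cos '' Set.Ioo 0 Real.pi = Set.Ioo (-1) 1 := by
    ext t
    constructor
    · rintro ⟨θ, hθ, rfl⟩
      have h1 := Real.strictAntiOn_cos (Set.left_mem_Icc.mpr Real.pi_pos.le)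
        (Set.Ioo_subset_Icc_self hθ) hθ.1
      have h2 := Real.strictAntiOn_cos (Set.Ioo_subset_Icc_self hθ)
        (Set.right_mem_Icc.mpr Real.pi_pos.le) hθ.2
      rw [Real.cos_zero] at h1
      rw [Real.cos_pi] at h2
      exact ⟨h2, h1⟩
    · intro ht
      exact ⟨Real.arccos t, ⟨Real.arccos_pos.mpr ht.2, by
        rw [lt_iff_le_and_ne]
        exact ⟨Real.arccos_le_pi t, fun h => by
          have := Real.cos_arccos ht.1.le ht.2.le
          rw [h, Real.cos_pi] at this
          linarith [ht.1]⟩⟩, Real.cos_arccos ht.1.le ht.2.le⟩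
  have h := lintegral_image_eq_lintegral_abs_deriv_mul (f := Real.cos)
    (f' := fun θ => -Real.sin θ) measurableSet_Ioo
    (fun θ (_ : θ ∈ Set.Ioo 0 Real.pi) => (Real.hasDerivAt_cos θ).hasDerivWithinAt)
    (Real.injOn_cos.mono Set.Ioo_subset_Icc_self) (A.indicator 1)
  rw [himg, lintegral_indicator_one hA, Measure.restrict_apply hA] at h
  rw [h]
  refine setLIntegral_congr_fun measurableSet_Ioo fun θ hθ => ?_
  simp only [abs_neg, abs_of_pos (Real.sin_pos_of_mem_Ioo hθ)]

lemma lintegral_sq_Ioo :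
    ∫⁻ R in Set.Ioi (0 : ℝ), ENNReal.ofReal (R ^ 2) * (Set.Iio 1).indicator 1 R =
      ENNReal.ofReal (1 / 3) := by
  have h1 : ∀ R : ℝ, ENNReal.ofReal (R ^ 2) * (Set.Iio (1 : ℝ)).indicator 1 R =
      (Set.Iio (1 : ℝ)).indicator (fun R => ENNReal.ofReal (R ^ 2)) R := by
    intro R
    by_cases h : R ∈ Set.Iio (1 : ℝ) <;> simp [h]
  simp only [h1]
  rw [setLIntegral_indicator measurableSet_Iio, Set.inter_comm, Set.Ioi_inter_Iio,
    ← ofReal_integral_eq_lintegral_ofReal]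
  · rw [← integral_Ioc_eq_integral_Ioo, ← intervalIntegral.integral_of_le zero_le_one, integral_pow]
    norm_num
  · exact ((continuous_pow 2).integrableOn_Icc (a := 0) (b := 1)).mono_set Set.Ioo_subset_Icc_self
  · exact Eventually.of_forall fun _ => sq_nonneg _

/-- Polar coordinates `z = R cos θ`, `ρ = R sin θ` in the meridian half-plane: `ρ dz dρ` becomes `R²
dR · sin θ dθ`. The radial factor is `1/3`, and `t = cos θ` makes the angular one a length. -/
lemma lintegral_coneSection {A : Set ℝ} (hA : MeasurableSet A) :
    ∫⁻ z : ℝ, ∫⁻ ρ in Set.Ioi (0 : ℝ), ENNReal.ofReal ρ * (coneSection A).indicator 1 (z, ρ) =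
      ENNReal.ofReal (1 / 3) * volume (A ∩ Set.Ioo (-1) 1) := by
  set H : ℝ × ℝ → ℝ≥0∞ := fun p => (Set.Ioi (0 : ℝ)).indicator
    (fun ρ => ENNReal.ofReal ρ * (coneSection A).indicator 1 (p.1, ρ)) p.2 with hH
  have hHm : Measurable H := by
    have h1 : H = fun p : ℝ × ℝ => (Set.univ ×ˢ Set.Ioi (0 : ℝ)).indicator
        (fun p : ℝ × ℝ => ENNReal.ofReal p.2 * (coneSection A).indicator 1 p) p := by
      funext p
      simp only [hH, Set.indicator_apply, Set.mem_prod, Set.mem_univ, true_and]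
    rw [h1]
    exact ((ENNReal.measurable_ofReal.comp measurable_snd).mul
      (measurable_one.indicator (measurableSet_coneSection hA))).indicator
      (MeasurableSet.univ.prod measurableSet_Ioi)
  calc _ = ∫⁻ z : ℝ, ∫⁻ ρ : ℝ, H (z, ρ) := by
        refine lintegral_congr fun z => ?_
        rw [← lintegral_indicator measurableSet_Ioi]
    _ = ∫⁻ p : ℝ × ℝ, H p := by
        rw [Measure.volume_eq_prod, lintegral_prod _ hHm.aemeasurable]
    _ = ∫⁻ p in polarCoord.target, (ENNReal.ofReal (p.1 ^ 2) * (Set.Iio 1).indicator 1 p.1) *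
          (Set.Ioi 0).indicator
            (fun θ => ENNReal.ofReal (Real.sin θ) * A.indicator 1 (Real.cos θ)) p.2 := by
        rw [← lintegral_comp_polarCoord_symm]
        refine setLIntegral_congr_fun polarCoord.open_target.measurableSet fun p hp => ?_
        rw [polarCoord_target] at hp
        obtain ⟨hR, hθ1, hθ2⟩ := hp
        simp only [Set.mem_Ioi] at hR
        have hsq : (p.1 * Real.cos p.2) ^ 2 + (p.1 * Real.sin p.2) ^ 2 = p.1 ^ 2 := by
          have := Real.cos_sq_add_sin_sq p.2
          linear_combination p.1 ^ 2 * this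
        have hmem : (p.1 * Real.cos p.2, p.1 * Real.sin p.2) ∈ coneSection A ↔
            p.1 ∈ Set.Iio (1 : ℝ) ∧ Real.cos p.2 ∈ A := by
          simp only [coneSection, Set.mem_ofPred_eq, hsq, Real.sqrt_sq hR.le,
            mul_div_cancel_left₀ _ hR.ne', Set.mem_Iio]
          have h0 : 0 < p.1 ^ 2 := by positivity
          have h1 : p.1 ^ 2 < 1 ↔ p.1 < 1 := by
            rw [sq_lt_one_iff_abs_lt_one, abs_of_pos hR]
          rw [h1]; tauto
        have hsin : p.1 * Real.sin p.2 ∈ Set.Ioi (0 : ℝ) ↔ p.2 ∈ Set.Ioi (0 : ℝ) := by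
          simp only [Set.mem_Ioi, mul_pos_iff_of_pos_left hR]
          constructor
          · intro h
            by_contra h2
            exact absurd (Real.sin_nonpos_of_nonpos_of_neg_pi_le (not_lt.mp h2) hθ1.le)
              (not_le.mpr h)
          · intro h
            exact Real.sin_pos_of_mem_Ioo ⟨h, hθ2⟩
        classical
        simp only [hH, polarCoord_symm_apply, Set.indicator_apply, hmem, hsin, Pi.one_apply,
          smul_eq_mul]
        by_cases h1 : p.2 ∈ Set.Ioi (0 : ℝ) <;> by_cases h2 : p.1 ∈ Set.Iio (1 : ℝ) <;>
          by_cases h3 : Real.cos p.2 ∈ A <;> simp only [h1, h2, h3, if_true, if_false, and_self,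
            and_false, false_and, mul_one, mul_zero, zero_mul]
        rw [ENNReal.ofReal_mul hR.le, sq, ENNReal.ofReal_mul hR.le, mul_assoc]
    _ = _ := by
        have hg : Measurable fun θ => ENNReal.ofReal (Real.sin θ) *
            A.indicator (1 : ℝ → ℝ≥0∞) (Real.cos θ) :=
          (ENNReal.measurable_ofReal.comp Real.measurable_sin).mul
            ((measurable_one.indicator hA).comp Real.measurable_cos)
        rw [lintegral_Ioi_mul_Ioo (f := fun R => ENNReal.ofReal (R ^ 2) *
            (Set.Iio (1 : ℝ)).indicator 1 R) (by
              exact (ENNReal.measurable_ofReal.comp (measurable_id.pow_const 2)).mul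
                (measurable_one.indicator measurableSet_Iio))
            (hg.indicator measurableSet_Ioi), lintegral_sq_Ioo,
          setLIntegral_indicator measurableSet_Ioi]
        have : Set.Ioi 0 ∩ Set.Ioo (-Real.pi) Real.pi = Set.Ioo 0 Real.pi := by
          ext θ
          simp only [Set.mem_inter_iff, Set.mem_Ioi, Set.mem_Ioo]
          constructor
          · rintro ⟨h1, _, h2⟩; exact ⟨h1, h2⟩
          · rintro ⟨h1, h2⟩; exact ⟨h1, by linarith [Real.pi_pos], h2⟩
        rw [this, lintegral_sin_Ioo hA]

/-- `toSphere` measures a set through the volume of the cone over it. Positive scaling changes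
neither the argument nor the height divided by the norm, so the cone is explicit in cylindrical
coordinates. -/
lemma Ioo_smul_cylinderCoord_preimage (A B : Set ℝ) :
    Set.Ioo (0 : ℝ) 1 • ((↑) '' (cylinderCoord ⁻¹' A ×ˢ B) : Set (EuclideanSpace ℝ (Fin 3))) =
      splitLast ⁻¹' {p | (p.1, ‖p.2‖) ∈ coneSection A ∧ Complex.arg p.2 ∈ B} := by
  have hn (y : EuclideanSpace ℝ (Fin 3)) :
      (y 2) ^ 2 + ‖(⟨y 0, y 1⟩ : ℂ)‖ ^ 2 = ‖y‖ ^ 2 := by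
    rw [EuclideanSpace.norm_sq_eq, Fin.sum_univ_three, ← Complex.normSq_eq_norm_sq,
      Complex.normSq_mk]
    simp only [Real.norm_eq_abs, sq_abs]
    ring
  ext y
  simp only [Set.mem_smul, Set.mem_image, Set.mem_preimage, splitLast_apply, Set.mem_ofPred_eq,
    coneSection, hn, Real.sqrt_sq (norm_nonneg y)]
  constructor
  · rintro ⟨c, hc, _, ⟨x, ⟨hx1, hx2⟩, rfl⟩, rfl⟩
    have hx : ‖(x : EuclideanSpace ℝ (Fin 3))‖ = 1 := by simp
    have hc0 : 0 < c := hc.1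
    have h1 : (⟨(c • (x : EuclideanSpace ℝ (Fin 3))) 0,
        (c • (x : EuclideanSpace ℝ (Fin 3))) 1⟩ : ℂ) = (c : ℂ) * ⟨x.1 0, x.1 1⟩ := by
      apply Complex.ext <;> simp
    rw [h1, Complex.arg_real_mul _ hc0, norm_smul, hx, Real.norm_of_nonneg hc0.le, mul_one]
    refine ⟨⟨by positivity, ?_, ?_⟩, hx2⟩
    · rw [sq_lt_one_iff_abs_lt_one, abs_of_pos hc0]; exact hc.2
    · have hx3 : x.1 2 ∈ A := hx1
      simpa [hc0.ne'] using hx3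
  · rintro ⟨⟨h0, h1, h2⟩, h3⟩
    have hy : 0 < ‖y‖ := by
      rcases (norm_nonneg y).lt_or_eq with h | h
      · exact h
      · simp [← h] at h0
    refine ⟨‖y‖, ⟨hy, by rwa [sq_lt_one_iff_abs_lt_one, abs_of_pos hy] at h1⟩, ‖y‖⁻¹ • y,
      ⟨⟨‖y‖⁻¹ • y, by simp [norm_smul, hy.ne']⟩, ⟨?_, ?_⟩, rfl⟩, ?_⟩
    · simpa [cylinderCoord, div_eq_inv_mul] using h2
    · have h4 : (⟨(‖y‖⁻¹ • y) 0, (‖y‖⁻¹ • y) 1⟩ : ℂ) = ((‖y‖⁻¹ : ℝ) : ℂ) * ⟨y 0, y 1⟩ := by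
        apply Complex.ext <;> simp [Complex.mul_re, Complex.mul_im, -Complex.ofReal_inv]
      simp only [cylinderCoord, longitude]
      rw [h4, Complex.arg_real_mul _ (by positivity)]
      exact h3
    · rw [smul_smul, mul_inv_cancel₀ hy.ne', one_smul]

/-- Archimedes' theorem: height and longitude are independent and uniformly distributed. -/
lemma map_cylinderCoord_surfaceMeasure :
    surfaceMeasure.map cylinderCoord = (volume.restrict (Set.Ioo (-1 : ℝ) 1)).prod
      (volume.restrict (Set.Ioo (-Real.pi) Real.pi)) := by
  refine (Measure.prod_eq fun A B hA hB => ?_).symm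
  rw [Measure.map_apply measurable_cylinderCoord (hA.prod hB), surfaceMeasure,
    Measure.toSphere_apply' _ (measurable_cylinderCoord (hA.prod hB)),
    Ioo_smul_cylinderCoord_preimage, Measure.restrict_apply hA, Measure.restrict_apply hB]
  have hm : MeasurableSet {p : ℝ × ℂ | (p.1, ‖p.2‖) ∈ coneSection A ∧ Complex.arg p.2 ∈ B} :=
    ((measurableSet_coneSection hA).preimage
      (measurable_fst.prodMk (measurable_norm.comp measurable_snd))).inter
      (hB.preimage (Complex.measurable_arg.comp measurable_snd))
  rw [measurePreserving_splitLast.measure_preimage hm.nullMeasurableSet, Measure.volume_eq_prod,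
    Measure.prod_apply hm]
  -- On a horizontal slice the condition on the argument is independent of the modulus, so plane
  -- polar coordinates split off the measure of `B`.
  have hinner (z : ℝ) : volume (Prod.mk z ⁻¹'
      {p : ℝ × ℂ | (p.1, ‖p.2‖) ∈ coneSection A ∧ Complex.arg p.2 ∈ B}) =
      (∫⁻ ρ in Set.Ioi (0 : ℝ), ENNReal.ofReal ρ * (coneSection A).indicator 1 (z, ρ)) *
        volume (B ∩ Set.Ioo (-Real.pi) Real.pi) := by
    rw [← lintegral_indicator_one (measurable_prodMk_left hm),
      ← Complex.lintegral_comp_polarCoord_symm]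
    rw [← Measure.restrict_apply hB, ← lintegral_indicator_one hB, ← lintegral_Ioi_mul_Ioo
      (f := fun ρ => ENNReal.ofReal ρ * (coneSection A).indicator 1 (z, ρ))
      (ENNReal.measurable_ofReal.mul ((measurable_one.indicator
        (measurableSet_coneSection hA)).comp measurable_prodMk_left))
      (measurable_one.indicator hB)]
    refine setLIntegral_congr_fun polarCoord.open_target.measurableSet fun p hp => ?_
    rw [polarCoord_target] at hp
    have hR : 0 < p.1 := hp.1
    have harg : Complex.arg (Complex.polarCoord.symm p) = p.2 := by
      rw [Complex.polarCoord_symm_apply]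
      simpa using Complex.arg_mul_cos_add_sin_mul_I hR ⟨hp.2.1, hp.2.2.le⟩
    classical
    simp only [Set.indicator_apply, Set.mem_preimage, Set.mem_ofPred_eq, harg,
      Complex.norm_polarCoord_symm, abs_of_pos hR, Pi.one_apply, smul_eq_mul]
    by_cases h1 : (z, p.1) ∈ coneSection A <;> by_cases h2 : p.2 ∈ B <;> simp [h1, h2]
  simp only [hinner]
  have hmeas : Measurable fun z : ℝ => ∫⁻ ρ in Set.Ioi (0 : ℝ),
      ENNReal.ofReal ρ * (coneSection A).indicator 1 (z, ρ) := by
    refine Measurable.lintegral_prod_right' (f := fun p : ℝ × ℝ =>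
      ENNReal.ofReal p.2 * (coneSection A).indicator 1 p) ?_
    exact (ENNReal.measurable_ofReal.comp measurable_snd).mul
      (measurable_one.indicator (measurableSet_coneSection hA))
  rw [lintegral_mul_const _ hmeas, lintegral_coneSection hA, ← mul_assoc, ← mul_assoc]
  congr 1
  -- The dimension factor in `toSphere` cancels the radial integral `1/3`.
  have h3 : ((3 : ℕ) : ℝ≥0∞) * ENNReal.ofReal (1 / 3) = 1 := by
    rw [← ENNReal.ofReal_natCast, ← ENNReal.ofReal_mul (by norm_num)]
    norm_num
  rw [finrank_euclideanSpace_fin, h3, one_mul]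

end

/-! ### Integrals of spherical harmonics over a cap -/

instance isFiniteMeasure_surfaceMeasure : IsFiniteMeasure surfaceMeasure := by
  unfold surfaceMeasure; infer_instance

/-- The heights of the points of the cap of radius `r`. -/
def capHeights (r : ℝ) : Set ℝ := {t | Real.arccos t ≤ r}

lemma measurableSet_capHeights (r : ℝ) : MeasurableSet (capHeights r) :=
  (isClosed_le Real.continuous_arccos continuous_const).measurableSet

lemma measurable_colatitude : Measurable colatitude :=
  Real.continuous_arccos.measurable.comp (measurable_fst.comp measurable_cylinderCoord)

lemma measurable_longitude : Measurable longitude :=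
  measurable_snd.comp measurable_cylinderCoord

lemma map_cylinderCoord_restrict_cap (r : ℝ) :
    (surfaceMeasure.restrict (cap r)).map cylinderCoord =
      (volume.restrict (capHeights r ∩ Set.Ioo (-1 : ℝ) 1)).prod
        (volume.restrict (Set.Ioo (-Real.pi) Real.pi)) := by
  have h : cap r = cylinderCoord ⁻¹' (capHeights r ×ˢ Set.univ) := by
    ext x; simp [cap, capHeights, cylinderCoord, colatitude]
  rw [h, ← Measure.restrict_map measurable_cylinderCoord
    ((measurableSet_capHeights r).prod MeasurableSet.univ), map_cylinderCoord_surfaceMeasure,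
    ← Measure.prod_restrict, Measure.restrict_univ, Measure.restrict_restrict
    (measurableSet_capHeights r)]

lemma setIntegral_cap_mul (r : ℝ) (f g : ℝ → ℂ) (hf : Measurable f) (hg : Measurable g) :
    ∫ x in cap r, f (x.1 2) * g (longitude x) ∂surfaceMeasure =
      (∫ t in capHeights r ∩ Set.Ioo (-1 : ℝ) 1, f t) *
        ∫ φ in Set.Ioo (-Real.pi) Real.pi, g φ := by
  rw [← integral_prod_mul, ← map_cylinderCoord_restrict_cap,
    integral_map measurable_cylinderCoord.aemeasurable]
  · rfl
  · exact ((hf.comp measurable_fst).mul (hg.comp measurable_snd)).aestronglyMeasurable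

lemma integral_exp_int_mul (k : ℤ) :
    ∫ φ in Set.Ioo (-Real.pi) Real.pi, Complex.exp (Complex.I * k * φ) =
      if k = 0 then 2 * (Real.pi : ℂ) else 0 := by
  rw [← integral_Ioc_eq_integral_Ioo, ← intervalIntegral.integral_of_le (by linarith [Real.pi_pos])]
  split_ifs with h
  · subst h
    simp; ring
  · have hk : Complex.I * k ≠ 0 := by simp [h]
    rw [integral_exp_mul_complex hk, sub_eq_zero.mpr, zero_div]
    rw [Complex.exp_eq_exp_iff_exists_int]
    exact ⟨k, by push_cast; ring⟩

/-- The modulus of `Y_{lm}`, up to sign. -/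
def harmonicAmplitude (l : ℕ) (m : ℤ) (t : ℝ) : ℝ :=
  (if 0 ≤ m then 1 else (-1) ^ m.natAbs) * (Real.sqrt ((2 * l + 1) / (4 * Real.pi)) *
    Real.sqrt (((l - m.natAbs).factorial : ℝ) / ((l + m.natAbs).factorial : ℝ)) *
      assocLegendre l m.natAbs t)

lemma sphHarmonic_eq (l : ℕ) (m : ℤ) (θ φ : ℝ) :
    sphHarmonic l m θ φ =
      (harmonicAmplitude l m (Real.cos θ) : ℂ) * Complex.exp (Complex.I * m * φ) := by
  rw [sphHarmonic, harmonicAmplitude]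
  split_ifs with h
  · have h2 : ((m.natAbs : ℕ) : ℂ) = (m : ℂ) := by
      rw [← Int.cast_natCast, Int.natAbs_of_nonneg h]
    rw [sphHarmonicNat, h2, one_mul]
  · have h2 : ((m.natAbs : ℕ) : ℂ) = -(m : ℂ) := by
      rw [← Int.cast_natCast, Int.ofNat_natAbs_of_nonpos (by omega)]; simp
    rw [sphHarmonicNat, map_mul, Complex.conj_ofReal, ← Complex.exp_conj, h2]
    simp only [map_mul, map_neg, Complex.conj_I, Complex.conj_ofReal, map_intCast]
    push_cast
    rw [show -Complex.I * -(m : ℂ) * φ = Complex.I * m * φ by ring]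
    ring

lemma harmonicAmplitude_sq (l : ℕ) (m : ℤ) {t : ℝ} (ht : t ∈ Set.Icc (-1 : ℝ) 1) :
    harmonicAmplitude l m t ^ 2 = (2 * l + 1) / (4 * Real.pi) * (assocSq l m.natAbs).eval t := by
  have h1 : (if 0 ≤ m then (1 : ℝ) else (-1) ^ m.natAbs) ^ 2 = 1 := by
    split_ifs
    · simp
    · rw [← pow_mul, mul_comm, pow_mul]; simp
  have h2 : 0 ≤ 1 - t ^ 2 := by nlinarith [ht.1, ht.2]
  have h3 : ((-1 : ℝ) ^ m.natAbs) ^ 2 = 1 := by rw [← pow_mul, mul_comm, pow_mul]; simp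
  have hπ := Real.pi_pos
  rw [harmonicAmplitude, mul_pow, h1, one_mul, mul_pow, mul_pow, Real.sq_sqrt (by positivity),
    Real.sq_sqrt (by positivity), assocLegendre, mul_pow, mul_pow, h3, one_mul, ← pow_mul,
    mul_comm m.natAbs 2, pow_mul, Real.sq_sqrt h2, assocSq]
  simp only [Polynomial.eval_mul, Polynomial.eval_C, Polynomial.eval_pow, Polynomial.eval_sub,
    Polynomial.eval_one, Polynomial.eval_X]
  ring

lemma continuous_harmonicAmplitude (l : ℕ) (m : ℤ) : Continuous (harmonicAmplitude l m) := by
  unfold harmonicAmplitude assocLegendre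
  have := (Polynomial.derivative^[m.natAbs] (legendre l)).continuous
  fun_prop

/-- A single term of Unsöld's sum, whose terms are nonnegative and whose weights are at least `1`.
-/
lemma eval_assocSq_le_one {l m : ℕ} (hm : m ≤ l) {t : ℝ} (ht : t ∈ Set.Icc (-1 : ℝ) 1) :
    (assocSq l m).eval t ≤ 1 := by
  have h := congrArg (Polynomial.eval t) (sum_assocSq l)
  simp only [Polynomial.eval_finsetSum, Polynomial.eval_mul, Polynomial.eval_C,
    Polynomial.eval_one] at h
  have hw (m : ℕ) : 1 ≤ orderMult m := by unfold orderMult; split_ifs <;> norm_num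
  have h0 (m : ℕ) := eval_assocSq_nonneg l m ht
  calc (assocSq l m).eval t ≤ orderMult m * (assocSq l m).eval t :=
        le_mul_of_one_le_left (h0 m) (hw m)
    _ ≤ _ := Finset.single_le_sum (f := fun m => orderMult m * (assocSq l m).eval t)
        (fun m _ => mul_nonneg (zero_le_one.trans (hw m)) (h0 m))
        (Finset.mem_range.mpr (Nat.lt_succ_of_le hm))
    _ = 1 := h

lemma measurable_sphHarmonic (l : ℕ) (m : ℤ) :
    Measurable fun x : Sphere2 => sphHarmonic l m (colatitude x) (longitude x) := by
  simp only [sphHarmonic_eq]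
  have h1 : Measurable fun x : Sphere2 => harmonicAmplitude l m (Real.cos (colatitude x)) :=
    (continuous_harmonicAmplitude l m).measurable.comp (Real.measurable_cos.comp
      measurable_colatitude)
  have h2 := measurable_longitude
  fun_prop

lemma norm_sphHarmonic_le {l : ℕ} {m : ℤ} (hm : m.natAbs ≤ l) (θ φ : ℝ) :
    ‖sphHarmonic l m θ φ‖ ^ 2 ≤ (2 * l + 1) / (4 * Real.pi) := by
  have hn : ‖Complex.exp (Complex.I * m * φ)‖ = 1 := by
    rw [show Complex.I * m * φ = ((m * φ : ℝ) : ℂ) * Complex.I by push_cast; ring,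
      Complex.norm_exp_ofReal_mul_I]
  have hπ := Real.pi_pos
  rw [sphHarmonic_eq, norm_mul, hn, mul_one, Complex.norm_real, Real.norm_eq_abs, sq_abs,
    harmonicAmplitude_sq l m (Real.cos_mem_Icc θ)]
  exact mul_le_of_le_one_right (by positivity) (eval_assocSq_le_one hm (Real.cos_mem_Icc θ))

lemma memLp_sphHarmonic {l : ℕ} {m : ℤ} (hm : m.natAbs ≤ l) :
    MemLp (fun x : Sphere2 => sphHarmonic l m (colatitude x) (longitude x)) 2 surfaceMeasure := by
  refine MemLp.of_bound (measurable_sphHarmonic l m).aestronglyMeasurable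
    (Real.sqrt ((2 * l + 1) / (4 * Real.pi))) (Eventually.of_forall fun x => ?_)
  exact Real.le_sqrt_of_sq_le (norm_sphHarmonic_le hm _ _)

lemma integrable_sphHarmonic_mul_conj {l : ℕ} {m n : ℤ} (hm : m.natAbs ≤ l) (hn : n.natAbs ≤ l) :
    Integrable (fun x : Sphere2 => sphHarmonic l m (colatitude x) (longitude x) *
      starRingEnd ℂ (sphHarmonic l n (colatitude x) (longitude x))) surfaceMeasure := by
  have h := (memLp_sphHarmonic hm).integrable_mul (memLp_sphHarmonic hn).star
  exact h

/-- The integral of a polynomial over the heights of the cap. -/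
def capIntegral (r : ℝ) (p : Polynomial ℝ) : ℝ :=
  ∫ t in capHeights r ∩ Set.Ioo (-1 : ℝ) 1, p.eval t

/-- In cylindrical coordinates the integrand splits. The longitude factor is `2π` or `0`, and `2π ·
(2l+1)/(4π) = (2l+1)/2`. -/
lemma setIntegral_cap_sphHarmonic (r : ℝ) (l : ℕ) (m n : ℤ) :
    ∫ x in cap r, sphHarmonic l m (colatitude x) (longitude x) *
      starRingEnd ℂ (sphHarmonic l n (colatitude x) (longitude x)) ∂surfaceMeasure =
    if m = n then (((2 * l + 1) / 2 * capIntegral r (assocSq l m.natAbs) : ℝ) : ℂ) else 0 := by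
  have h1 (x : Sphere2) : sphHarmonic l m (colatitude x) (longitude x) *
      starRingEnd ℂ (sphHarmonic l n (colatitude x) (longitude x)) =
      ((harmonicAmplitude l m (Real.cos (Real.arccos (x.1 2))) *
        harmonicAmplitude l n (Real.cos (Real.arccos (x.1 2))) : ℝ) : ℂ) *
      Complex.exp (Complex.I * ((m - n : ℤ) : ℂ) * longitude x) := by
    rw [sphHarmonic_eq, sphHarmonic_eq, map_mul, Complex.conj_ofReal, ← Complex.exp_conj]
    simp only [map_mul, Complex.conj_I, Complex.conj_ofReal, map_intCast]
    rw [show Complex.I * ((m - n : ℤ) : ℂ) * longitude x =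
      Complex.I * m * longitude x + -Complex.I * n * longitude x by push_cast; ring,
      Complex.exp_add]
    simp only [colatitude]
    push_cast
    ring
  simp only [h1]
  have hc : Continuous fun t : ℝ => harmonicAmplitude l m (Real.cos (Real.arccos t)) *
      harmonicAmplitude l n (Real.cos (Real.arccos t)) := by
    have hc1 := continuous_harmonicAmplitude l m
    have hc2 := continuous_harmonicAmplitude l n
    have hc3 := Real.continuous_cos.comp Real.continuous_arccos
    exact (hc1.comp hc3).mul (hc2.comp hc3)
  rw [setIntegral_cap_mul r (fun t => ((harmonicAmplitude l m (Real.cos (Real.arccos t)) *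
        harmonicAmplitude l n (Real.cos (Real.arccos t)) : ℝ) : ℂ))
      (fun φ => Complex.exp (Complex.I * ((m - n : ℤ) : ℂ) * φ))
      (Complex.measurable_ofReal.comp hc.measurable) (by fun_prop), integral_exp_int_mul]
  simp only [sub_eq_zero]
  split_ifs with h
  · subst h
    rw [integral_complex_ofReal]
    have h2 : ∫ t in capHeights r ∩ Set.Ioo (-1 : ℝ) 1,
        harmonicAmplitude l m (Real.cos (Real.arccos t)) *
          harmonicAmplitude l m (Real.cos (Real.arccos t)) =
        (2 * l + 1) / (4 * Real.pi) * capIntegral r (assocSq l m.natAbs) := by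
      rw [capIntegral, ← integral_const_mul]
      refine setIntegral_congr_fun ((measurableSet_capHeights r).inter measurableSet_Ioo)
        fun t ht => ?_
      rw [Real.cos_arccos ht.2.1.le ht.2.2.le, ← sq,
        harmonicAmplitude_sq l m (Set.Ioo_subset_Icc_self ht.2)]
    rw [h2]
    have hπ : (Real.pi : ℂ) ≠ 0 := by exact_mod_cast Real.pi_ne_zero
    push_cast
    field_simp
    ring
  · simp

/-! ### The second chaos as a diagonal quadratic form in the coefficients -/

lemma hermiteTwo_eq {Ω : Type*} (l : ℕ) (a : ℤ → Ω → ℂ) (ω : Ω) (x : Sphere2) :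
    hermiteTwo l a ω x = randomHarmonic l a ω x ^ 2 - 1 := by
  have h : Polynomial.hermite 2 = Polynomial.X ^ 2 - 1 := by
    simp [Polynomial.hermite_succ, sq]
  rw [hermiteTwo, h]; simp

section Chaos

variable {Ω : Type*} [MeasurableSpace Ω] {l : ℕ} {a : ℤ → Ω → ℂ} {P : Measure Ω}

lemma randomHarmonic_sq (ha : IsGaussianCoeff l a P) (ω : Ω) (x : Sphere2) :
    ((randomHarmonic l a ω x ^ 2 : ℝ) : ℂ) = ((4 * Real.pi / (2 * l + 1) : ℝ) : ℂ) *
      ∑ m ∈ Finset.Icc (-(l : ℤ)) l, ∑ n ∈ Finset.Icc (-(l : ℤ)) l,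
        a m ω * starRingEnd ℂ (a n ω) * (sphHarmonic l m (colatitude x) (longitude x) *
          starRingEnd ℂ (sphHarmonic l n (colatitude x) (longitude x))) := by
  have h : ((randomHarmonic l a ω x ^ 2 : ℝ) : ℂ) =
      harmonicSum l a ω x * starRingEnd ℂ (harmonicSum l a ω x) := by
    rw [harmonicSum_eq ha, Complex.conj_ofReal]; push_cast; ring
  have hπ := Real.pi_pos
  have hs : ((Real.sqrt (4 * Real.pi / (2 * l + 1)) : ℝ) : ℂ) *
      ((Real.sqrt (4 * Real.pi / (2 * l + 1)) : ℝ) : ℂ) =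
        ((4 * Real.pi / (2 * l + 1) : ℝ) : ℂ) := by
    rw [← Complex.ofReal_mul, Real.mul_self_sqrt (by positivity)]
  rw [h, harmonicSum, map_mul, Complex.conj_ofReal, map_sum, mul_mul_mul_comm, hs,
    Finset.sum_mul_sum]
  congr 1
  refine Finset.sum_congr rfl fun m _ => Finset.sum_congr rfl fun n _ => ?_
  rw [map_mul]; ring

lemma integrable_randomHarmonic_sq (ha : IsGaussianCoeff l a P) (ω : Ω) :
    Integrable (fun x => ((randomHarmonic l a ω x ^ 2 : ℝ) : ℂ)) surfaceMeasure := by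
  simp only [randomHarmonic_sq ha]
  refine (integrable_finsetSum _ fun m hm => integrable_finsetSum _ fun n hn => ?_).const_mul _
  rw [Finset.mem_Icc] at hm hn
  exact (integrable_sphHarmonic_mul_conj (by omega) (by omega)).const_mul _

lemma integrable_hermiteTwo (ha : IsGaussianCoeff l a P) (ω : Ω) :
    Integrable (hermiteTwo l a ω) surfaceMeasure := by
  have h : hermiteTwo l a ω = fun x => randomHarmonic l a ω x ^ 2 - 1 :=
    funext (hermiteTwo_eq l a ω)
  rw [h]
  exact (integrable_randomHarmonic_sq ha ω).re.sub (integrable_const 1)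

lemma sum_Icc_neg_natAbs (l : ℕ) (f : ℕ → ℝ) :
    ∑ m ∈ Finset.Icc (-(l : ℤ)) l, f m.natAbs =
      ∑ m ∈ Finset.range (l + 1), orderMult m * f m := by
  induction l with
  | zero => simp [orderMult]
  | succ l ih =>
    have h : Finset.Icc (-((l + 1 : ℕ) : ℤ)) ((l + 1 : ℕ) : ℤ) =
        insert (-((l + 1 : ℕ) : ℤ)) (insert ((l + 1 : ℕ) : ℤ) (Finset.Icc (-(l : ℤ)) l)) := by
      ext m; simp only [Finset.mem_Icc, Finset.mem_insert]; omega
    rw [h, Finset.sum_insert (by simp only [Finset.mem_insert, Finset.mem_Icc]; omega),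
      Finset.sum_insert (by simp only [Finset.mem_Icc]; omega), ih, Finset.sum_range_succ _ (l + 1),
      Int.natAbs_neg, Int.natAbs_natCast]
    simp only [orderMult, if_neg (Nat.succ_ne_zero l)]
    ring

lemma normSq_coeff_natAbs (ha : IsGaussianCoeff l a P) {m : ℤ} (hm : m.natAbs ≤ l) (ω : Ω) :
    Complex.normSq (a m ω) = Complex.normSq (a (m.natAbs : ℤ) ω) := by
  rcases Int.natAbs_eq m with h | h
  · rw [← h]
  · have h2 := ha.conj_symm (m.natAbs : ℤ) (by rwa [Int.natAbs_natCast]) ω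
    rw [← h] at h2
    rw [h2, map_mul, map_pow, Complex.normSq_conj]
    simp

/-- Only diagonal terms survive, with constant `4π/(2l+1) · (2l+1)/2 = 2π`. The orders `±m` merge
because `|a_{-m}| = |a_m|`, which leaves independent variables. -/
lemma setIntegral_randomHarmonic_sq (ha : IsGaussianCoeff l a P) (r : ℝ) (ω : Ω) :
    ∫ x in cap r, randomHarmonic l a ω x ^ 2 ∂surfaceMeasure =
      ∑ m ∈ Finset.range (l + 1), orderMult m * (2 * Real.pi * capIntegral r (assocSq l m)) *
        Complex.normSq (a (m : ℤ) ω) := by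
  have h : ((∫ x in cap r, randomHarmonic l a ω x ^ 2 ∂surfaceMeasure : ℝ) : ℂ) =
      ((∑ m ∈ Finset.Icc (-(l : ℤ)) l, 2 * Real.pi * capIntegral r (assocSq l m.natAbs) *
        Complex.normSq (a (m.natAbs : ℤ) ω) : ℝ) : ℂ) := by
    rw [← integral_complex_ofReal]
    simp only [randomHarmonic_sq ha]
    have hint (m n : ℤ) (hm : m ∈ Finset.Icc (-(l : ℤ)) l) (hn : n ∈ Finset.Icc (-(l : ℤ)) l) :
        Integrable (fun x => a m ω * starRingEnd ℂ (a n ω) *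
          (sphHarmonic l m (colatitude x) (longitude x) *
          starRingEnd ℂ (sphHarmonic l n (colatitude x) (longitude x))))
          (surfaceMeasure.restrict (cap r)) := by
      rw [Finset.mem_Icc] at hm hn
      exact ((integrable_sphHarmonic_mul_conj (by omega) (by omega)).const_mul _).integrableOn
    rw [integral_const_mul, integral_finsetSum _ fun m hm => integrable_finsetSum _ fun n hn =>
      hint m n hm hn, Complex.ofReal_sum, Finset.mul_sum]
    refine Finset.sum_congr rfl fun m hm => ?_
    rw [integral_finsetSum _ fun n hn => hint m n hm hn, Finset.sum_eq_single_of_mem m hm]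
    · have hm' := hm
      rw [Finset.mem_Icc] at hm'
      rw [integral_const_mul, setIntegral_cap_sphHarmonic, if_pos rfl, Complex.mul_conj,
        normSq_coeff_natAbs ha (by omega)]
      have : (2 * (l : ℂ) + 1) ≠ 0 := by exact_mod_cast (by omega : 2 * l + 1 ≠ 0)
      push_cast
      field_simp
      ring
    · intro n _ hnm
      rw [integral_const_mul, setIntegral_cap_sphHarmonic, if_neg hnm.symm, mul_zero]
  have h2 := Complex.ofReal_injective h
  rw [h2, sum_Icc_neg_natAbs l (fun m => 2 * Real.pi * capIntegral r (assocSq l m) *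
        Complex.normSq (a (m : ℤ) ω))]
  exact Finset.sum_congr rfl fun m _ => by ring

lemma secondChaos_eq (ha : IsGaussianCoeff l a P) (r : ℝ) (ω : Ω) :
    secondChaos r l a ω =
      ∑ m : Fin (l + 1), orderMult m * (2 * Real.pi * capIntegral r (assocSq l m)) *
        Complex.normSq (a ((m : ℕ) : ℤ) ω) + -surfaceMeasure.real (cap r) := by
  rw [secondChaos]
  simp only [hermiteTwo_eq]
  have hi : IntegrableOn (fun x => randomHarmonic l a ω x ^ 2) (cap r) surfaceMeasure :=
    (integrable_randomHarmonic_sq ha ω).re.integrableOn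
  rw [integral_sub hi (integrable_const 1), setIntegral_randomHarmonic_sq ha,
    Fin.sum_univ_eq_sum_range (fun m => orderMult m * (2 * Real.pi * capIntegral r (assocSq l m)) *
        Complex.normSq (a (m : ℤ) ω)) (l + 1)]
  simp [sub_eq_add_neg]

end Chaos

section

open scoped NNReal

/-! ### Moments of Gaussian variables -/

/-- Differentiation acts on the polynomial prefactor by `p ↦ p' + v X p`, so Gaussian moments reduce
to polynomial evaluations at `0`. -/
lemma iteratedDeriv_poly_mul_exp (v : ℝ) (n : ℕ) :
    iteratedDeriv n (fun t : ℝ => Real.exp (v * t ^ 2 / 2)) = fun t =>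
      (((fun p : Polynomial ℝ => Polynomial.derivative p + Polynomial.C v * Polynomial.X * p)^[n]
        1).eval t) * Real.exp (v * t ^ 2 / 2) := by
  induction n with
  | zero => simp
  | succ n ih =>
    rw [iteratedDeriv_succ, ih, Function.iterate_succ_apply']
    generalize (fun p : Polynomial ℝ =>
      Polynomial.derivative p + Polynomial.C v * Polynomial.X * p)^[n] 1 = q
    funext t
    have h1 : HasDerivAt (fun t : ℝ => v * t ^ 2 / 2) (v * t) t := by
      have := ((hasDerivAt_pow 2 t).const_mul v).div_const 2
      refine this.congr_deriv ?_
      norm_num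
      ring
    refine ((q.hasDerivAt t).mul h1.exp).deriv.trans ?_
    simp only [Polynomial.eval_add, Polynomial.eval_mul, Polynomial.eval_C, Polynomial.eval_X]
    ring

lemma mem_interior_integrableExpSet_gaussianReal (v : ℝ≥0) :
    0 ∈ interior (integrableExpSet id (gaussianReal 0 v)) := by
  rw [integrableExpSet_id_gaussianReal, interior_univ]; trivial

lemma integral_pow_gaussianReal (v : ℝ≥0) (n : ℕ) :
    ∫ x, x ^ n ∂gaussianReal 0 v =
      (((fun p : Polynomial ℝ => Polynomial.derivative p +
        Polynomial.C (v : ℝ) * Polynomial.X * p)^[n] 1).eval 0) := by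
  have h := iteratedDeriv_mgf_zero (mem_interior_integrableExpSet_gaussianReal v) n
  have h2 : mgf id (gaussianReal 0 v) = fun t : ℝ => Real.exp (v * t ^ 2 / 2) := by
    rw [mgf_id_gaussianReal]; simp
  rw [h2, iteratedDeriv_poly_mul_exp] at h
  simpa using h.symm

lemma integrable_pow_gaussianReal (v : ℝ≥0) (n : ℕ) :
    Integrable (fun x : ℝ => x ^ n) (gaussianReal 0 v) :=
  integrable_pow_of_mem_interior_integrableExpSet
    (mem_interior_integrableExpSet_gaussianReal v) n

lemma memLp_sq_gaussianReal (v : ℝ≥0) : MemLp (fun x : ℝ => x ^ 2) 2 (gaussianReal 0 v) := by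
  rw [memLp_two_iff_integrable_sq (by fun_prop)]
  simpa only [← pow_mul] using integrable_pow_gaussianReal v 4

lemma variance_sq_gaussianReal (v : ℝ≥0) :
    variance (fun x : ℝ => x ^ 2) (gaussianReal 0 v) = 2 * (v : ℝ) ^ 2 := by
  rw [variance_eq_sub (memLp_sq_gaussianReal v)]
  simp only [Pi.pow_apply, ← pow_mul]
  rw [integral_pow_gaussianReal, integral_pow_gaussianReal]
  simp [Function.iterate_succ_apply', Polynomial.derivative_mul]
  ring

lemma memLp_normSq_stdComplexGaussian : MemLp Complex.normSq 2 stdComplexGaussian := by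
  have hm : Measurable fun p : ℝ × ℝ => (⟨p.1, p.2⟩ : ℂ) :=
    Complex.measurableEquivRealProd.symm.measurable
  rw [stdComplexGaussian, memLp_map_measure_iff
    Complex.continuous_normSq.measurable.aestronglyMeasurable hm.aemeasurable]
  have h1 := (memLp_sq_gaussianReal (1 / 2)).comp_fst (gaussianReal 0 (1 / 2))
  have h2 := (memLp_sq_gaussianReal (1 / 2)).comp_snd (gaussianReal 0 (1 / 2))
  convert! h1.add h2 using 1
  funext p
  simp [Complex.normSq_mk, sq]

lemma variance_normSq_stdComplexGaussian : variance Complex.normSq stdComplexGaussian = 1 := by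
  have hm : Measurable fun p : ℝ × ℝ => (⟨p.1, p.2⟩ : ℂ) :=
    Complex.measurableEquivRealProd.symm.measurable
  rw [stdComplexGaussian, variance_map Complex.continuous_normSq.measurable.aemeasurable
    hm.aemeasurable]
  have h := variance_add_prod (memLp_sq_gaussianReal (1 / 2)) (memLp_sq_gaussianReal (1 / 2))
  rw [variance_sq_gaussianReal] at h
  convert! h using 1
  · congr 1
    funext p
    simp [Complex.normSq_mk, sq]
  · norm_num

/-! ### The variance of the second chaos -/

section Chaos

variable {Ω : Type*} [MeasurableSpace Ω] {l : ℕ} {a : ℤ → Ω → ℂ} {P : Measure Ω}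

lemma memLp_normSq_coeff (ha : IsGaussianCoeff l a P) (m : Fin (l + 1)) :
    MemLp (fun ω => Complex.normSq (a ((m : ℕ) : ℤ) ω)) 2 P := by
  have hn := Complex.continuous_normSq.measurable
  rcases Nat.eq_zero_or_pos (m : ℕ) with h | h
  · rw [h]
    have hl := ha.law_zero
    refine (memLp_map_measure_iff (g := Complex.normSq) hn.aestronglyMeasurable
      hl.aemeasurable).mp ?_
    rw [hl.map_eq, memLp_map_measure_iff hn.aestronglyMeasurable (by fun_prop)]
    convert! memLp_sq_gaussianReal 1 using 1
    funext t
    simp [Complex.normSq_ofReal, sq]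
  · have hl := ha.law_pos m h (by omega)
    refine (memLp_map_measure_iff (g := Complex.normSq) hn.aestronglyMeasurable
      hl.aemeasurable).mp ?_
    rw [hl.map_eq]
    exact memLp_normSq_stdComplexGaussian

/-- The variance is `2` for the real coefficient and `1` for the complex ones; in this form it
cancels one of the two weights in `variance_secondChaos`. -/
lemma variance_normSq_coeff (ha : IsGaussianCoeff l a P) (m : Fin (l + 1)) :
    variance (fun ω => Complex.normSq (a ((m : ℕ) : ℤ) ω)) P = 2 / orderMult m := by
  have hn := Complex.continuous_normSq.measurable
  rcases Nat.eq_zero_or_pos (m : ℕ) with h | h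
  · rw [h]
    have hl := ha.law_zero
    have h2 := variance_map (X := Complex.normSq) hn.aemeasurable hl.aemeasurable
    rw [hl.map_eq, variance_map hn.aemeasurable (by fun_prop)] at h2
    have h3 : (Complex.normSq ∘ fun t : ℝ => (t : ℂ)) = fun t => t ^ 2 := by
      funext t
      simp [Complex.normSq_ofReal, sq]
    rw [h3, variance_sq_gaussianReal] at h2
    simp only [orderMult, if_true, div_one]
    refine Eq.trans h2.symm ?_
    simp
  · have hl := ha.law_pos m h (by omega)
    have h2 := variance_map (X := Complex.normSq) hn.aemeasurable hl.aemeasurable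
    rw [hl.map_eq, variance_normSq_stdComplexGaussian] at h2
    simp only [orderMult, if_neg h.ne', div_self (two_ne_zero (α := ℝ))]
    exact h2.symm

lemma secondChaos_eq_sum_add (ha : IsGaussianCoeff l a P) (r : ℝ) :
    secondChaos r l a = fun ω => (∑ m : Fin (l + 1), fun ω =>
      orderMult m * (2 * Real.pi * capIntegral r (assocSq l m)) *
        Complex.normSq (a ((m : ℕ) : ℤ) ω)) ω + -surfaceMeasure.real (cap r) := by
  funext ω
  rw [secondChaos_eq ha, Finset.sum_apply]

variable [IsProbabilityMeasure P]

lemma memLp_secondChaos (ha : IsGaussianCoeff l a P) (r : ℝ) :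
    MemLp (secondChaos r l a) 2 P := by
  rw [secondChaos_eq_sum_add ha]
  exact (memLp_finsetSum' _ fun m _ => (memLp_normSq_coeff ha m).const_mul _).add
    (memLp_const _)

/-- By independence the variances add: with weight `w` and cap integral `I`, each term is `(w · 2π
I)² · 2/w = 8π² w I²`. -/
lemma variance_secondChaos (ha : IsGaussianCoeff l a P) (r : ℝ) :
    variance (secondChaos r l a) P = 8 * Real.pi ^ 2 *
      ∑ m ∈ Finset.range (l + 1), orderMult m * capIntegral r (assocSq l m) ^ 2 := by
  have hL (m : Fin (l + 1)) := (memLp_normSq_coeff ha m).const_mul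
    (orderMult m * (2 * Real.pi * capIntegral r (assocSq l m)))
  rw [secondChaos_eq_sum_add ha, variance_add_const
    (memLp_finsetSum' _ fun m _ => hL m).aestronglyMeasurable,
    IndepFun.variance_sum (fun m _ => hL m)]
  · rw [Finset.mul_sum, ← Fin.sum_univ_eq_sum_range (fun m => 8 * Real.pi ^ 2 *
      (orderMult m * capIntegral r (assocSq l m) ^ 2)) (l + 1)]
    refine Finset.sum_congr rfl fun m _ => ?_
    rw [variance_const_mul, variance_normSq_coeff ha]
    have : orderMult m ≠ 0 := by unfold orderMult; split_ifs <;> norm_num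
    field_simp
    ring
  · intro m _ n _ hmn
    have hn := Complex.continuous_normSq.measurable
    exact (ha.indep.indepFun hmn).comp
      (φ := fun z => orderMult m * (2 * Real.pi * capIntegral r (assocSq l m)) * Complex.normSq z)
      (ψ := fun z => orderMult n * (2 * Real.pi * capIntegral r (assocSq l n)) * Complex.normSq z)
      (hn.const_mul _) (hn.const_mul _)

end Chaos

end

/-! ### Comparison with the smoothed cap -/

/-- The indicator function of the cap of radius `r`, as a function of the height. -/
def capIndicator (r t : ℝ) : ℝ := (capHeights r).indicator 1 t

lemma capIndicator_mem_Icc (r t : ℝ) : capIndicator r t ∈ Set.Icc (0 : ℝ) 1 := by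
  by_cases h : t ∈ capHeights r <;> simp [capIndicator, h]

lemma bernsteinStep_mem_Icc (k : ℕ) {t : ℝ} (ht : t ∈ Set.Icc (0 : ℝ) 1) :
    bernsteinStep k t ∈ Set.Icc (0 : ℝ) 1 := by
  have h0 (n i : ℕ) : 0 ≤ (bernsteinPolynomial ℝ n i).eval t := by
    have h1 := ht.1
    have h2 : 0 ≤ 1 - t := sub_nonneg.mpr ht.2
    simp only [bernsteinPolynomial, Polynomial.eval_mul, Polynomial.eval_pow, Polynomial.eval_X,
      Polynomial.eval_sub, Polynomial.eval_one, Polynomial.eval_natCast]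
    positivity
  refine ⟨Finset.sum_nonneg fun i _ => h0 _ i, ?_⟩
  have h := congrArg (Polynomial.eval t) (bernsteinPolynomial.sum ℝ (2 * k + 1))
  rw [Polynomial.eval_finsetSum, Polynomial.eval_one] at h
  rw [← h]
  exact Finset.sum_le_sum_of_subset_of_nonneg (Finset.range_subset_range.mpr (by omega))
    fun i _ _ => h0 _ i

lemma smoothCap_mem_Icc (k : ℕ) {r ε : ℝ} (hε : 0 < ε) (θ : ℝ) :
    smoothCap k r ε θ ∈ Set.Icc (0 : ℝ) 1 := by
  rw [smoothCap]
  split_ifs with h1 h2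
  · simp
  · refine bernsteinStep_mem_Icc k ⟨div_nonneg (by linarith) hε.le, ?_⟩
    rw [div_le_one hε]; linarith
  · simp

lemma measurable_smoothCap (k : ℕ) (r ε : ℝ) : Measurable (smoothCap k r ε) := by
  have h : Continuous (bernsteinStep k) :=
    continuous_finsetSum _ fun i _ => (bernsteinPolynomial ℝ (2 * k + 1) i).continuous
  refine Measurable.ite measurableSet_Iio measurable_const
    (Measurable.ite measurableSet_Iic (h.measurable.comp ?_) measurable_const)
  fun_prop

lemma intervalIntegrable_of_mem_Icc {f : ℝ → ℝ} (hf : Measurable f)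
    (h : ∀ t, f t ∈ Set.Icc (0 : ℝ) 1) : IntervalIntegrable f volume (-1) 1 := by
  refine (intervalIntegrable_const (c := (1 : ℝ))).mono_fun hf.aestronglyMeasurable
    (Eventually.of_forall fun t => ?_)
  simp only [Real.norm_of_nonneg (h t).1, norm_one]
  exact (h t).2

lemma intervalIntegrable_capIndicator (r : ℝ) :
    IntervalIntegrable (capIndicator r) volume (-1) 1 :=
  intervalIntegrable_of_mem_Icc (measurable_one.indicator (measurableSet_capHeights r))
    (capIndicator_mem_Icc r)

lemma intervalIntegrable_smoothCap (k : ℕ) (r : ℝ) {ε : ℝ} (hε : 0 < ε) :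
    IntervalIntegrable (fun t => smoothCap k r ε (Real.arccos t)) volume (-1) 1 :=
  intervalIntegrable_of_mem_Icc
    ((measurable_smoothCap k r ε).comp Real.continuous_arccos.measurable)
    fun _ => smoothCap_mem_Icc k hε _

lemma weightedIntegral_capIndicator (r : ℝ) (p : Polynomial ℝ) :
    weightedIntegral (capIndicator r) (intervalIntegrable_capIndicator r) p = capIntegral r p := by
  change ∫ t in (-1 : ℝ)..1, capIndicator r t * p.eval t = _
  rw [intervalIntegral.integral_of_le (by norm_num), integral_Ioc_eq_integral_Ioo, capIntegral,
    Set.inter_comm, ← setIntegral_indicator (measurableSet_capHeights r)]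
  refine integral_congr_ae (Eventually.of_forall fun t => ?_)
  by_cases h : t ∈ capHeights r <;> simp [capIndicator, h]

/-- The profiles can differ only for colatitudes in `[r - ε, r]`. As `cos` is decreasing and
1-Lipschitz, the heights then lie in `[cos r, cos r + ε]`. -/
lemma abs_capIndicator_sub_smoothCap_le (k : ℕ) {r ε t : ℝ} (hrpi : r < Real.pi)
    (hε : 0 < ε) (ht : t ∈ Set.Icc (-1 : ℝ) 1) :
    |capIndicator r t - smoothCap k r ε (Real.arccos t)| ≤
      (Set.Icc (Real.cos r) (Real.cos r + ε)).indicator 1 t := by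
  have h1 := capIndicator_mem_Icc r t
  have h2 := smoothCap_mem_Icc k (r := r) hε (Real.arccos t)
  by_cases h : t ∈ Set.Icc (Real.cos r) (Real.cos r + ε)
  · rw [Set.indicator_of_mem h, Pi.one_apply, abs_le]
    exact ⟨by linarith [h1.1, h2.2], by linarith [h1.2, h2.1]⟩
  · rw [Set.indicator_of_notMem h]
    refine (abs_eq_zero.mpr ?_).le
    have hcos := Real.cos_arccos ht.1 ht.2
    rcases lt_or_ge r (Real.arccos t) with h3 | h3
    · rw [smoothCap, if_neg (by linarith), if_neg (not_le.mpr h3), capIndicator,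
        Set.indicator_of_notMem (by simpa [capHeights] using h3), sub_zero]
    · have h4 : Real.arccos t < r - ε := by
        by_contra hc
        refine h ⟨?_, ?_⟩
        · rw [← hcos]
          exact Real.cos_le_cos_of_nonneg_of_le_pi (Real.arccos_nonneg t) hrpi.le h3
        · have h5 := Real.abs_cos_sub_cos_le (Real.arccos t) r
          rw [hcos, abs_of_nonpos (by linarith : Real.arccos t - r ≤ 0)] at h5
          linarith [le_abs_self (t - Real.cos r)]
      rw [smoothCap, if_pos h4, capIndicator, Set.indicator_of_mem (by exact h3)]
      simp

lemma intervalIntegrable_abs_sub (k : ℕ) (r : ℝ) {ε : ℝ} (hε : 0 < ε) :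
    IntervalIntegrable (fun t => |capIndicator r t - smoothCap k r ε (Real.arccos t)|)
      volume (-1) 1 :=
  ((intervalIntegrable_capIndicator r).sub (intervalIntegrable_smoothCap k r hε)).abs

lemma integral_abs_capIndicator_sub_le (k : ℕ) {r ε : ℝ} (hrpi : r < Real.pi)
    (hε : 0 < ε) :
    ∫ t in (-1 : ℝ)..1, |capIndicator r t - smoothCap k r ε (Real.arccos t)| ≤ ε := by
  have hI : IntervalIntegrable ((Set.Icc (Real.cos r) (Real.cos r + ε)).indicator (1 : ℝ → ℝ))
      volume (-1) 1 := by
    refine intervalIntegrable_of_mem_Icc (measurable_one.indicator measurableSet_Icc) fun t => ?_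
    by_cases h : t ∈ Set.Icc (Real.cos r) (Real.cos r + ε) <;> simp [h]
  refine (intervalIntegral.integral_mono_on (by norm_num) (intervalIntegrable_abs_sub k r hε) hI
    fun t ht => abs_capIndicator_sub_smoothCap_le k hrpi hε ht).trans ?_
  rw [intervalIntegral.integral_of_le (by norm_num), setIntegral_indicator measurableSet_Icc]
  simp only [Pi.one_apply, integral_const, smul_eq_mul, mul_one, measureReal_restrict_apply_univ]
  calc _ ≤ volume.real (Set.Icc (Real.cos r) (Real.cos r + ε)) :=
        measureReal_mono Set.inter_subset_right (by simp)
    _ = ε := by rw [Real.volume_real_Icc_of_le (by linarith)]; ring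

lemma weightedIntegral_mem_Icc {f : ℝ → ℝ} (hf : IntervalIntegrable f volume (-1) 1)
    (h : ∀ t, f t ∈ Set.Icc (0 : ℝ) 1) {p : Polynomial ℝ}
    (hp : ∀ t ∈ Set.Icc (-1 : ℝ) 1, 0 ≤ p.eval t) :
    weightedIntegral f hf p ∈ Set.Icc 0 (polyIntegral p) := by
  rw [polyIntegral_apply]
  refine ⟨intervalIntegral.integral_nonneg (by norm_num) fun t ht => mul_nonneg (h t).1 (hp t ht),
    intervalIntegral.integral_mono_on (by norm_num)
      (hf.mul_continuousOn p.continuous.continuousOn) (p.continuous.intervalIntegrable _ _)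
      fun t ht => mul_le_of_le_one_left (hp t ht) (h t).2⟩

lemma abs_weightedIntegral_sub_le {f g : ℝ → ℝ} (hf : IntervalIntegrable f volume (-1) 1)
    (hg : IntervalIntegrable g volume (-1) 1)
    (hfg : IntervalIntegrable (fun t => |f t - g t|) volume (-1) 1) {p : Polynomial ℝ}
    (hp : ∀ t ∈ Set.Icc (-1 : ℝ) 1, 0 ≤ p.eval t) :
    |weightedIntegral f hf p - weightedIntegral g hg p| ≤ weightedIntegral _ hfg p := by
  change |(∫ t in (-1 : ℝ)..1, f t * p.eval t) - ∫ t in (-1 : ℝ)..1, g t * p.eval t| ≤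
    ∫ t in (-1 : ℝ)..1, |f t - g t| * p.eval t
  rw [← intervalIntegral.integral_sub (hf.mul_continuousOn p.continuous.continuousOn)
    (hg.mul_continuousOn p.continuous.continuousOn)]
  refine (intervalIntegral.abs_integral_le_integral_abs (by norm_num)).trans
    (le_of_eq (intervalIntegral.integral_congr fun t ht => ?_))
  rw [Set.uIcc_of_le (by norm_num)] at ht
  simp only [← sub_mul, abs_mul, abs_of_nonneg (hp t ht)]

/-- The quadratic form of the variance is Lipschitz in `L¹` with constant `O(1 / l)`. -/
lemma abs_sum_sq_weightedIntegral_sub_le (l : ℕ) {f g : ℝ → ℝ}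
    (hf : IntervalIntegrable f volume (-1) 1) (hg : IntervalIntegrable g volume (-1) 1)
    (hfg : IntervalIntegrable (fun t => |f t - g t|) volume (-1) 1)
    (hf01 : ∀ t, f t ∈ Set.Icc (0 : ℝ) 1) (hg01 : ∀ t, g t ∈ Set.Icc (0 : ℝ) 1) :
    |∑ m ∈ Finset.range (l + 1), orderMult m * weightedIntegral f hf (assocSq l m) ^ 2 -
      ∑ m ∈ Finset.range (l + 1), orderMult m * weightedIntegral g hg (assocSq l m) ^ 2| ≤
    4 / (2 * l + 1) * ∫ t in (-1 : ℝ)..1, |f t - g t| := by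
  -- Unsöld's theorem integrated against `|f - g|`.
  have hsum : ∑ m ∈ Finset.range (l + 1), orderMult m * weightedIntegral _ hfg (assocSq l m) =
      ∫ t in (-1 : ℝ)..1, |f t - g t| := by
    have h := congrArg (weightedIntegral _ hfg) (sum_assocSq l)
    simp only [← Polynomial.smul_eq_C_mul, map_sum, map_smul, smul_eq_mul] at h
    rw [h]
    simp [weightedIntegral]
  rw [← Finset.sum_sub_distrib, ← hsum, Finset.mul_sum]
  refine (Finset.abs_sum_le_sum_abs _ _).trans (Finset.sum_le_sum fun m hm => ?_)
  have hml : m ≤ l := Nat.lt_succ_iff.mp (Finset.mem_range.mp hm)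
  have hp (t : ℝ) (ht : t ∈ Set.Icc (-1 : ℝ) 1) := eval_assocSq_nonneg l m ht
  have h1 := weightedIntegral_mem_Icc hf hf01 hp
  have h2 := weightedIntegral_mem_Icc hg hg01 hp
  have h3 := abs_weightedIntegral_sub_le hf hg hfg hp
  rw [polyIntegral_assocSq hml] at h1 h2
  have hw : 0 ≤ orderMult m := by unfold orderMult; split_ifs <;> norm_num
  -- In `(x + y)(x - y)` the first factor is at most twice `2/(2l+1)`; the second is summed by
  -- `hsum`.
  rw [← mul_sub, sq_sub_sq, abs_mul, abs_mul, abs_of_nonneg hw,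
    abs_of_nonneg (add_nonneg h1.1 h2.1), mul_left_comm (4 / (2 * (l : ℝ) + 1))]
  refine mul_le_mul_of_nonneg_left (mul_le_mul ?_ h3 (abs_nonneg _) (by positivity)) hw
  calc _ ≤ 2 / (2 * (l : ℝ) + 1) + 2 / (2 * l + 1) := add_le_add h1.2 h2.2
    _ = _ := by ring

/-! ### The series of the smoothed cap -/

lemma varianceTerm_of_lt (k : ℕ) (r ε : ℝ) {l L : ℕ} (h : 2 * l < L) :
    varianceTerm k r ε l L = 0 := by
  rw [varianceTerm, clebschGordan_of_lt h]; simp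

lemma varianceTerm_eq_zero_of_notMem (k : ℕ) (r ε : ℝ) {l L : ℕ}
    (h : L ∉ Finset.range (2 * l + 1)) : varianceTerm k r ε l L = 0 :=
  varianceTerm_of_lt k r ε (by simpa [Nat.lt_succ_iff] using h)

/-- Parseval for the smoothed-cap functional. The constants combine as `4π² · (2L+1)/(4π) · 1/(2L+1)
= π`. -/
lemma tsum_varianceTerm (k : ℕ) (r : ℝ) {ε : ℝ} (hε : 0 < ε) (l : ℕ) :
    8 * Real.pi * ∑' L, varianceTerm k r ε l L = 8 * Real.pi ^ 2 *
      ∑ m ∈ Finset.range (l + 1), orderMult m *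
        weightedIntegral _ (intervalIntegrable_smoothCap k r hε) (assocSq l m) ^ 2 := by
  rw [tsum_eq_sum fun L hL => varianceTerm_eq_zero_of_notMem k r ε hL, sum_sq_assocSq,
    Finset.mul_sum, Finset.mul_sum]
  refine Finset.sum_congr rfl fun L hL => ?_
  have hπ := Real.pi_pos
  rw [varianceTerm, clebschGordan_sq (Nat.lt_succ_iff.mp (Finset.mem_range.mp hL)), capCoeff,
    mul_pow, mul_pow, Real.sq_sqrt (by positivity)]
  change _ = 8 * Real.pi ^ 2 * (_ * (∫ μ in (-1 : ℝ)..1,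
    smoothCap k r ε (Real.arccos μ) * (legendre L).eval μ) ^ 2)
  have : (2 * (L : ℝ) + 1) ≠ 0 := by positivity
  field_simp
  ring

end

end CapChaos

/-! ### The asymptotic variance -/

theorem proposition2 {Ω : Type*} [MeasurableSpace Ω] (P : Measure Ω) [IsProbabilityMeasure P]
    (a : ℕ → ℤ → Ω → ℂ) (ha : ∀ l, CapChaos.IsGaussianCoeff l (a l) P)
    (r : ℝ) (hr0 : 0 < r) (hrpi : r < Real.pi)
    (M k : ℕ) (hM : 1 ≤ M) (hMk : M ≤ k)
    (ε : ℕ → ℝ) (hεpos : ∀ l, 0 < ε l) (hεlim : Tendsto ε atTop (𝓝 0))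
    (hεM : ∀ᶠ l : ℕ in atTop, (l : ℝ) ^ 2 < (l : ℝ) ^ (M - 1) * ε l ^ (2 * M + 1)) :
    (∀ l ω, IntegrableOn (CapChaos.hermiteTwo l (a l) ω) (CapChaos.cap r)
      CapChaos.surfaceMeasure) ∧
    (∀ l, MemLp (CapChaos.secondChaos r l (a l)) 2 P) ∧
    (∀ l, Summable (CapChaos.varianceTerm k r (ε l) l)) ∧
    (fun l : ℕ => variance (CapChaos.secondChaos r l (a l)) P -
        8 * Real.pi * ∑' l₁ : ℕ, CapChaos.varianceTerm k r (ε l) l l₁)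
      =o[atTop] (fun l : ℕ => 1 / (l : ℝ)) := by
  refine ⟨fun l ω => (CapChaos.integrable_hermiteTwo (ha l) ω).integrableOn,
    fun l => CapChaos.memLp_secondChaos (ha l) r,
    fun l => summable_of_ne_finset_zero (s := Finset.range (2 * l + 1))
      fun L hL => CapChaos.varianceTerm_eq_zero_of_notMem k r (ε l) hL, ?_⟩
  -- Both quantities are `8π²` times the same quadratic form, at the sharp and at the smoothed
  -- profile, so the Lipschitz bound applies for every `l`.
  have hbound (l : ℕ) : |variance (CapChaos.secondChaos r l (a l)) P -
      8 * Real.pi * ∑' l₁ : ℕ, CapChaos.varianceTerm k r (ε l) l l₁| ≤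
      8 * Real.pi ^ 2 * (4 / (2 * l + 1) * ε l) := by
    rw [CapChaos.variance_secondChaos (ha l), CapChaos.tsum_varianceTerm k r (hεpos l), ← mul_sub,
      abs_mul, abs_of_nonneg (by positivity : 0 ≤ 8 * Real.pi ^ 2)]
    simp only [← CapChaos.weightedIntegral_capIndicator]
    refine mul_le_mul_of_nonneg_left ?_ (by positivity)
    refine (CapChaos.abs_sum_sq_weightedIntegral_sub_le l _ _
      (CapChaos.intervalIntegrable_abs_sub k r (hεpos l)) (CapChaos.capIndicator_mem_Icc r)
      fun t => CapChaos.smoothCap_mem_Icc k (hεpos l) _).trans ?_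
    exact mul_le_mul_of_nonneg_left
      (CapChaos.integral_abs_capIndicator_sub_le k hrpi (hεpos l)) (by positivity)
  have hO : (fun l : ℕ => variance (CapChaos.secondChaos r l (a l)) P -
      8 * Real.pi * ∑' l₁ : ℕ, CapChaos.varianceTerm k r (ε l) l l₁) =O[atTop]
      (fun l : ℕ => ε l * (1 / (l : ℝ))) := by
    refine IsBigO.of_bound (16 * Real.pi ^ 2) ?_
    filter_upwards [eventually_gt_atTop 0] with l hl
    have hl' : (0 : ℝ) < l := by exact_mod_cast hl
    have hε := hεpos l
    rw [Real.norm_eq_abs, Real.norm_of_nonneg (by positivity)]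
    refine (hbound l).trans ?_
    have h : 4 / (2 * (l : ℝ) + 1) ≤ 2 * (1 / l) := by
      rw [div_le_iff₀ (by positivity)]
      field_simp
      linarith
    calc 8 * Real.pi ^ 2 * (4 / (2 * l + 1) * ε l)
        ≤ 8 * Real.pi ^ 2 * (2 * (1 / l) * ε l) := by gcongr
      _ = 16 * Real.pi ^ 2 * (ε l * (1 / l)) := by ring
  have ho : (fun l : ℕ => ε l * (1 / (l : ℝ))) =o[atTop] (fun l : ℕ => 1 * (1 / (l : ℝ))) :=
    ((isLittleO_one_iff ℝ).mpr hεlim).mul_isBigO (isBigO_refl _ _)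
  simpa using hO.trans_isLittleO ho
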